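/- Consider one user whose channel is a Markov chain on $\{1,\dots,K\}$, $K\ge 1$, with transition matrix $P$; write $p_{ji}^{(\tau)}=(P^\tau)_{ji}$. The belief states are $\vec\pi_j^\tau=\vec e_jP^\tau$, $1\le j\le K$, $\tau\ge 1$ (the channel was last observed $\tau$ slots ago, in state $j$); they are treated as labelled by $(j,\tau)$. In each slot the user is either passive, with reward $R(\vec\pi_j^\tau,0)+W$, and then the belief state moves from $\vec\pi_j^\tau$ to $\vec\pi_j^{\tau+1}$, or active, with reward $R^1$, and then the belief state moves to $\vec\pi_i^1$ with probability $p_{ji}^{(\tau)}$ in the original POMDP, and with probability $p_i^s$ (the steady-state probability of channel state $i$) in the approximation. Here $W\in\mathbb R$ is a fixed subsidy, and $R^1\ge R(\vec\pi_j^\tau,0)\ge R(\vec\pi_j^{\tau'},0)$ for all $j$ and all $\tau'\ge\tau\ge 1$. For $0\le\beta<1$ let $V_\beta(\pi)$ be the supremum over all policies of the expected total $\beta$-discounted reward in the original POMDP from the belief state $\pi$, and let $V_\beta^{\max}$ and $V_\beta^{\min}$ be the bounded solutions of $$V_\beta^{\max}(\vec\pi_j^\tau)=\max\{R(\vec\pi_j^\tau,0)+W+\beta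 V_\beta^{\max}(\vec\pi_j^{\tau+1});\ R^1+\beta\max_iV_\beta^{\max}(\vec\pi_i^1)\},$$ $$V_\beta^{\min}(\vec\pi_j^\tau)=\max\{R(\vec\pi_j^\tau,0)+W+\beta V_\beta^{\min}(\vec\pi_j^{\tau+1});\ R^1+\beta\min_iV_\beta^{\min}(\vec\pi_i^1)\}.$$ (i) For every $0\le\beta<1$ these bounded solutions exist and are unique, and $V_\beta^{\min}(\pi)\le V_\beta(\pi)\le V_\beta^{\max}(\pi)$ for every belief state $\pi$. (ii) Suppose that $P$ is irreducible, with stationary distribution $(p_1^s,\dots,p_K^s)$, and that $R^1>0$. Then the optimal long-run expected average rewards (the suprema over all policies of $\liminf_{T\to\infty}\frac1T\mathbb E\sum_{t=1}^T r_t$, where $r_t$ is the reward of slot $t$) of the original POMDP and of the approximation are real numbers $g(W)$ and $g^{app}(W)$ that do not depend on the initial belief state. The limits $g^{\max}(W)=\lim_{\beta\to1}(1-\beta)V_\beta^{\max}(\pi)$ and $g^{\min}(W,\pi)=\lim_{\beta\to1}(1-\beta)V_\beta^{\min}(\pi)$ exist for every belief state $\pi$, the former is independent of $\pi$, $0<g^{\min}(W,\pi)\le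 g(W)\le g^{\max}(W)$, and for every belief state $\pi$ $$\left|1-\frac{g^{app}(W)}{g(W)}\right|\le D(W):=\max\left\{1-\frac{g^{app}(W)}{g^{\max}(W)},\ \frac{g^{app}(W)}{g^{\min}(W,\pi)}-1\right\}.$$ -/

import Mathlib

open Filter Topology Matrix

noncomputable section

namespace PilotAllocation

/-- The belief states of one user: `(j, τ)` stands for the belief vector `e_j P ^ τ`, `τ ≥ 1`, that
is, the user was last sensed `τ` slots ago and its channel was then seen in state `j`. -/
abbrev BeliefState (K : ℕ) := Fin K × ℕ+

/-- The transition probabilities `q ^ a (s, s')` between belief states. The action `true` is the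
active one (allocate a pilot), `false` the passive one. Under the passive action the belief only
ages by one slot. Under the active action in state `s` the channel is observed, and it is found in
state `i` with probability `ρ s i`; the next belief state is then `(i, 1)`. -/
def trans {K : ℕ} (ρ : BeliefState K → Fin K → ℝ) :
    Bool → BeliefState K → BeliefState K → ℝ
  | false, s, s' => if s'.1 = s.1 ∧ s'.2 = s.2 + 1 then 1 else 0
  | true, s, s' => if s'.2 = 1 then ρ s s'.1 else 0

/-- Observation probabilities of the original POMDP: the channel is found in state `i` with the
probability `p_{ji}^{(τ)}`, the `(j, i)` entry of `P ^ τ`. -/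
def exactObs {K : ℕ} (P : Matrix (Fin K) (Fin K) ℝ) : BeliefState K → Fin K → ℝ :=
  fun s i => (P ^ (s.2 : ℕ)) s.1 i

/-- Observation probabilities of the approximation: the channel is found in state `i` with the
steady-state probability `p_i^s`, whatever the belief state. -/
def approxObs {K : ℕ} (ps : Fin K → ℝ) : BeliefState K → Fin K → ℝ :=
  fun _ i => ps i

/-- Average immediate reward, including the subsidy `W` for passivity: `R1` when active, and
`R0 j τ + W` when passive in the belief state `(j, τ)`. -/
def reward {K : ℕ} (R0 : Fin K → ℕ+ → ℝ) (R1 W : ℝ) : Bool → BeliefState K → ℝ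
  | false, s => R0 s.1 s.2 + W
  | true, _ => R1

/-- A policy: it picks the action from the list of the past belief states (the most recent one
first) and the current belief state. -/
abbrev Policy (K : ℕ) := List (BeliefState K) → BeliefState K → Bool

/-- The expected reward collected `t` slots after the present one under the policy `φ`, given
the past `h` and the present belief state `s`. -/
def expectedReward {K : ℕ} (ρ : BeliefState K → Fin K → ℝ) (R0 : Fin K → ℕ+ → ℝ) (R1 W : ℝ)
    (φ : Policy K) : ℕ → List (BeliefState K) → BeliefState K → ℝ
  | 0, h, s => reward R0 R1 W (φ h s) s
  | t + 1, h, s =>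
      ∑' s', trans ρ (φ h s) s s' * expectedReward ρ R0 R1 W φ t (s :: h) s'

/-- The value function `V_β` of the `β`-discounted single-arm problem: the supremum over all
policies of the (lower limit of the) total expected discounted reward from the initial state `s`. -/
def discountedValue {K : ℕ} (ρ : BeliefState K → Fin K → ℝ) (R0 : Fin K → ℕ+ → ℝ) (R1 W : ℝ)
    (β : ℝ) (s : BeliefState K) : EReal :=
  ⨆ φ : Policy K, liminf (fun T : ℕ =>
    ((∑ t ∈ Finset.range T, β ^ t * expectedReward ρ R0 R1 W φ t [] s : ℝ) : EReal)) atTop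

/-- The optimal long-run expected average reward from the initial state `s`. -/
def optimalAverage {K : ℕ} (ρ : BeliefState K → Fin K → ℝ) (R0 : Fin K → ℕ+ → ℝ) (R1 W : ℝ)
    (s : BeliefState K) : EReal :=
  ⨆ φ : Policy K, liminf (fun T : ℕ =>
    (((∑ t ∈ Finset.range T, expectedReward ρ R0 R1 W φ t [] s) / T : ℝ) : EReal)) atTop

/-- `V` is the value function `V_β^max`: the bounded solution of the Bellman equation in which
an active action is followed by the best of the states `(i, 1)`. -/
def IsMaxValue {K : ℕ} (R0 : Fin K → ℕ+ → ℝ) (R1 W β : ℝ) (V : BeliefState K → ℝ) : Prop :=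
  (∃ C, ∀ s, |V s| ≤ C) ∧
  ∀ j τ, V (j, τ) = max (R0 j τ + W + β * V (j, τ + 1)) (R1 + β * ⨆ i, V (i, 1))

/-- `V` is the value function `V_β^min`: the bounded solution of the Bellman equation in which
an active action is followed by the worst of the states `(i, 1)`. -/
def IsMinValue {K : ℕ} (R0 : Fin K → ℕ+ → ℝ) (R1 W β : ℝ) (V : BeliefState K → ℝ) : Prop :=
  (∃ C, ∀ s, |V s| ≤ C) ∧
  ∀ j τ, V (j, τ) = max (R0 j τ + W + β * V (j, τ + 1)) (R1 + β * ⨅ i, V (i, 1))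

/-- The expectation of `f` over the next belief state after a passive action. -/
theorem tsum_trans_false {K : ℕ} (ρ : BeliefState K → Fin K → ℝ) (s : BeliefState K)
    (f : BeliefState K → ℝ) : ∑' s', trans ρ false s s' * f s' = f (s.1, s.2 + 1) := by
  rw [tsum_eq_single (s.1, s.2 + 1)]
  · simp [trans]
  · rintro ⟨i, σ⟩ h
    have : ¬ (i = s.1 ∧ σ = s.2 + 1) := fun h' => h (Prod.ext h'.1 h'.2)
    simp [trans, this]

/-- The expectation of `f` over the next belief state after an active action. -/
theorem tsum_trans_true {K : ℕ} (ρ : BeliefState K → Fin K → ℝ) (s : BeliefState K)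
    (f : BeliefState K → ℝ) : ∑' s', trans ρ true s s' * f s' = ∑ i, ρ s i * f (i, 1) := by
  rw [tsum_eq_sum (s := Finset.univ.image fun i : Fin K => ((i, 1) : BeliefState K)),
    Finset.sum_image (fun a _ b _ h => (Prod.ext_iff.1 h).1)]
  · simp [trans]
  · rintro ⟨i, σ⟩ h
    have : σ ≠ 1 := by
      rintro rfl
      exact h (Finset.mem_image.2 ⟨i, Finset.mem_univ i, rfl⟩)
    simp [trans, this]

end PilotAllocation

end

/-!
Each of the value functions is a bounded solution of `V = F (β V)`, where the undiscounted Bellman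
operator `F` is monotone and commutes with constants. Such equations have a comparison principle:
bounded solutions exist and are unique, and enlarging the evaluation of the uncertain next state
from the worst case over the expectation to the best case enlarges `V`.

With `H = β V` the equation reads `F H = H + (1 - β) V`. Comparing two discount factors `β` and `β'`
by a maximum principle gives `inf (1 - β) V_β ≤ sup (1 - β') V_β'`, so when the oscillation of `V_β`
stays bounded as `β → 1`, all the functions `(1 - β) V_β` share a constant limit, and `H` is an
approximate solution of the average-reward equation, which makes that constant the optimal average.
For `V^max` the oscillation is bounded because one active slot gives access to the best state
`(i, 1)`. For an expectation, iterating the always-active inequality `R + β Q v ≤ v` along the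
powers of the irreducible matrix `Q` bounds `v` above by its minimum.

The oscillation of `V^min` can be unbounded. But `min_i V^min(i, 1)` is the least of the values of
the one-arm problems, which are of the `V^max` type; so `(1 - β) min_i V^min(i, 1)` has a limit `μ`,
and given this each arm is an optimal stopping problem, with limit `inf_N max (r_j(N), μ)`.
-/

noncomputable section

namespace PilotAllocation

section Topical

variable {α S : Type*}

/-- Subtopical maps, i.e. monotone maps with `F (V + c) ≤ F V + c` for all constants `c ≥ 0`, both
properties being encoded in one implication. These are the maps with a comparison principle for
discounted fixed points. -/
def IsSubtopical (F : (α → ℝ) → S → ℝ) : Prop :=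
  ∀ ⦃U V : α → ℝ⦄ ⦃c : ℝ⦄, 0 ≤ c → (∀ a, U a ≤ V a + c) → ∀ s, F U s ≤ F V s + c

/-- Topical maps, i.e. monotone maps that commute with the addition of constants, both properties
being encoded in one implication. Bellman operators are of this kind. -/
def IsTopical (F : (α → ℝ) → S → ℝ) : Prop :=
  ∀ ⦃U V : α → ℝ⦄ ⦃c : ℝ⦄, (∀ a, U a ≤ V a + c) → ∀ s, F U s ≤ F V s + c

theorem IsTopical.isSubtopical {F : (α → ℝ) → S → ℝ} (hF : IsTopical F) : IsSubtopical F :=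
  fun _ _ _ _ h => hF h

theorem IsSubtopical.abs_sub_le {F : (α → ℝ) → S → ℝ} (hF : IsSubtopical F) {U V : α → ℝ} {c : ℝ}
    (hc : 0 ≤ c) (h : ∀ a, |U a - V a| ≤ c) (s : S) : |F U s - F V s| ≤ c := by
  have hle : ∀ {U V : α → ℝ}, (∀ a, U a - V a ≤ c) → F U s - F V s ≤ c := fun h =>
    sub_le_iff_le_add'.2 (hF hc (fun a => sub_le_iff_le_add'.1 (h a)) s)
  exact abs_sub_le_iff.2
    ⟨hle fun a => (abs_sub_le_iff.1 (h a)).1, hle fun a => (abs_sub_le_iff.1 (h a)).2⟩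

theorem IsSubtopical.le_of_le_apply_of_apply_le {F : (S → ℝ) → S → ℝ} (hF : IsSubtopical F)
    {β : ℝ} (hβ : β ∈ Set.Ico (0 : ℝ) 1) {U V : S → ℝ} (hU : BddAbove (Set.range U))
    (hV : BddBelow (Set.range V)) (hUF : U ≤ F (β • U)) (hFV : F (β • V) ≤ V) : U ≤ V := fun s => by
  have : Nonempty S := ⟨s⟩
  have hbdd : BddAbove (Set.range fun s => U s - V s) := by
    obtain ⟨A, hA⟩ := hU
    obtain ⟨B, hB⟩ := hV
    exact ⟨A - B, Set.forall_mem_range.2 fun s => sub_le_sub (hA ⟨s, rfl⟩) (hB ⟨s, rfl⟩)⟩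
  set D := ⨆ s, (U s - V s)
  have hD : ∀ s, U s ≤ V s + D := fun s => sub_le_iff_le_add'.1 (le_ciSup hbdd s)
  suffices hD0 : D ≤ 0 by linarith [hD s]
  by_contra! hD0
  have hFD := hF (U := β • U) (V := β • V) (mul_nonneg hβ.1 hD0.le) fun s => by
    simpa [mul_add] using mul_le_mul_of_nonneg_left (hD s) hβ.1
  have hDβ : D ≤ β * D := ciSup_le fun s => by linarith [hFD s, hUF s, hFV s]
  nlinarith [hβ.2]

theorem IsTopical.le_of_add_le_of_le_add [Nonempty S] {F : (S → ℝ) → S → ℝ} (hF : IsTopical F)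
    {U V : S → ℝ} {a b : ℝ} (hUV : BddAbove (Set.range (U - V))) (hUF : ∀ s, U s + a ≤ F U s)
    (hFV : ∀ s, F V s ≤ V s + b) : a ≤ b := by
  set D := ⨆ s, (U - V) s
  have hFD := hF (U := U) (V := V) (c := D) fun s => sub_le_iff_le_add'.1 (le_ciSup hUV s)
  have hDab : D ≤ D + b - a := ciSup_le fun s => by
    simp only [Pi.sub_apply]
    linarith [hFD s, hUF s, hFV s]
  linarith

end Topical

section Discounted

variable {S : Type*} {F G : (S → ℝ) → S → ℝ} {β β' : ℝ} {U V V' : S → ℝ}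

theorem add_mul_div_one_sub (hβ : β < 1) (B : ℝ) : B + β * (B / (1 - β)) = B / (1 - β) := by
  have := (sub_pos.2 hβ).ne'
  field_simp
  ring

/-- The bounded solutions `V` of the `β`-discounted Bellman equation `V = F (β • V)`, where `F` is
the undiscounted Bellman operator. -/
structure IsDiscountedValue (F : (S → ℝ) → S → ℝ) (β : ℝ) (V : S → ℝ) : Prop where
  bounded : ∃ C, ∀ s, |V s| ≤ C
  eq_apply : V = F (β • V)

namespace IsDiscountedValue

theorem bddAbove (hV : IsDiscountedValue F β V) : BddAbove (Set.range V) :=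
  let ⟨C, hC⟩ := hV.bounded
  ⟨C, Set.forall_mem_range.2 fun s => (abs_le.1 (hC s)).2⟩

theorem bddBelow (hV : IsDiscountedValue F β V) : BddBelow (Set.range V) :=
  let ⟨C, hC⟩ := hV.bounded
  ⟨-C, Set.forall_mem_range.2 fun s => (abs_le.1 (hC s)).1⟩

theorem le_of_apply_le (hV : IsDiscountedValue F β V) (hF : IsSubtopical F)
    (hβ : β ∈ Set.Ico (0 : ℝ) 1) (hU : BddBelow (Set.range U)) (hFU : F (β • U) ≤ U) : V ≤ U :=
  hF.le_of_le_apply_of_apply_le hβ hV.bddAbove hU hV.eq_apply.le hFU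

theorem le_of_le_apply (hV : IsDiscountedValue F β V) (hF : IsSubtopical F)
    (hβ : β ∈ Set.Ico (0 : ℝ) 1) (hU : BddAbove (Set.range U)) (hUF : U ≤ F (β • U)) : U ≤ V :=
  hF.le_of_le_apply_of_apply_le hβ hU hV.bddBelow hUF hV.eq_apply.ge

theorem mono (hV : IsDiscountedValue F β V) (hU : IsDiscountedValue G β U) (hG : IsSubtopical G)
    (hβ : β ∈ Set.Ico (0 : ℝ) 1) (hFG : F ≤ G) : V ≤ U :=
  hU.le_of_le_apply hG hβ hV.bddAbove (hV.eq_apply.le.trans (hFG _))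

theorem unique (hV : IsDiscountedValue F β V) (hU : IsDiscountedValue F β U) (hF : IsSubtopical F)
    (hβ : β ∈ Set.Ico (0 : ℝ) 1) : V = U :=
  le_antisymm (hV.mono hU hF hβ le_rfl) (hU.mono hV hF hβ le_rfl)

theorem one_sub_mul_le (hV : IsDiscountedValue F β V) (hF : IsTopical F)
    (hβ : β ∈ Set.Ico (0 : ℝ) 1) {B : ℝ} (hB : ∀ s, F 0 s ≤ B) (s : S) : (1 - β) * V s ≤ B := by
  refine (le_div_iff₀' (sub_pos.2 hβ.2)).1 ?_
  refine hV.le_of_apply_le hF.isSubtopical hβ (U := fun _ => B / (1 - β))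
    ⟨_, by rintro _ ⟨_, rfl⟩; rfl⟩ (fun s => ?_) s
  have hFB := hF (U := β • fun _ => B / (1 - β)) (V := 0) (fun s => (zero_add _).ge) s
  exact hFB.trans ((add_le_add_left (hB s) _).trans_eq (add_mul_div_one_sub hβ.2 B))

theorem le_one_sub_mul (hV : IsDiscountedValue F β V) (hF : IsTopical F)
    (hβ : β ∈ Set.Ico (0 : ℝ) 1) {B : ℝ} (hB : ∀ s, B ≤ F 0 s) (s : S) : B ≤ (1 - β) * V s := by
  refine (div_le_iff₀' (sub_pos.2 hβ.2)).1 ?_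
  refine hV.le_of_le_apply hF.isSubtopical hβ (U := fun _ => B / (1 - β))
    ⟨_, by rintro _ ⟨_, rfl⟩; rfl⟩ (fun s => ?_) s
  have hFB := hF (U := 0) (V := β • fun _ => B / (1 - β)) (c := -(β * (B / (1 - β))))
    (fun s => (add_neg_cancel _).ge) s
  linarith [hB s, add_mul_div_one_sub hβ.2 B]

theorem apply_smul_eq (hV : IsDiscountedValue F β V) (s : S) :
    F (β • V) s = (β • V) s + (1 - β) * V s := by
  rw [← hV.eq_apply]
  simp only [Pi.smul_apply, smul_eq_mul]
  ring

/-- With `H = β • V` the Bellman equation reads `F H = H + (1 - β) • V`, so that `(1 - β) • V` is an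
approximate eigenvalue of `F`, and these are compared by `IsTopical.le_of_add_le_of_le_add`. -/
theorem le_of_le_one_sub_mul [Nonempty S] (hV : IsDiscountedValue F β V)
    (hV' : IsDiscountedValue F β' V') (hF : IsTopical F) {a b : ℝ}
    (ha : ∀ s, a ≤ (1 - β) * V s) (hb : ∀ s, (1 - β') * V' s ≤ b) : a ≤ b := by
  refine hF.le_of_add_le_of_le_add (U := β • V) (V := β' • V') ?_
    (fun s => by linarith [hV.apply_smul_eq s, ha s])
    (fun s => by linarith [hV'.apply_smul_eq s, hb s])
  obtain ⟨C, hC⟩ := hV.bounded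
  obtain ⟨C', hC'⟩ := hV'.bounded
  refine ⟨|β| * C + |β'| * C', Set.forall_mem_range.2 fun s => (le_abs_self _).trans ?_⟩
  refine (abs_sub _ _).trans (add_le_add ?_ ?_) <;>
    simp only [Pi.smul_apply, smul_eq_mul, abs_mul] <;> gcongr <;> apply_assumption

end IsDiscountedValue

theorem IsSubtopical.exists_isDiscountedValue (hF : IsSubtopical F) (h0 : ∃ C, ∀ s, |F 0 s| ≤ C)
    (hβ : β ∈ Set.Ico (0 : ℝ) 1) : ∃ V, IsDiscountedValue F β V := by
  let : TopologicalSpace S := ⊥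
  have : DiscreteTopology S := ⟨rfl⟩
  obtain ⟨C, hC⟩ := h0
  have hlip : ∀ f g : BoundedContinuousFunction S ℝ, ∀ s,
      |F (β • ⇑f) s - F (β • ⇑g) s| ≤ β * dist f g := fun f g =>
    hF.abs_sub_le (mul_nonneg hβ.1 dist_nonneg) fun s => by
      rw [Pi.smul_apply, Pi.smul_apply, ← smul_sub, smul_eq_mul, abs_mul, abs_of_nonneg hβ.1]
      exact mul_le_mul_of_nonneg_left (f.dist_coe_le_dist s) hβ.1
  have hbound : ∀ f : BoundedContinuousFunction S ℝ, ∀ s, ‖F (β • ⇑f) s‖ ≤ β * dist f 0 + C :=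
    fun f s => by
      have hf0 : |F (β • ⇑f) s - F 0 s| ≤ β * dist f 0 := by simpa using hlip f 0 s
      rw [Real.norm_eq_abs]
      linarith [abs_sub_abs_le_abs_sub (F (β • ⇑f) s) (F 0 s), hC s]
  let T : BoundedContinuousFunction S ℝ → BoundedContinuousFunction S ℝ := fun f =>
    BoundedContinuousFunction.ofNormedAddCommGroupDiscrete _ _ (hbound f)
  have hT : ContractingWith ⟨β, hβ.1⟩ T :=
    ⟨mod_cast hβ.2, LipschitzWith.of_dist_le_mul fun f g =>
      (BoundedContinuousFunction.dist_le (mul_nonneg hβ.1 dist_nonneg)).2 (hlip f g)⟩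
  exact ⟨hT.fixedPoint, ⟨_, hT.fixedPoint.norm_coe_le_norm⟩,
    congrArg DFunLike.coe hT.fixedPoint_isFixedPt.symm⟩

theorem IsSubtopical.existsUnique_isDiscountedValue (hF : IsSubtopical F)
    (h0 : ∃ C, ∀ s, |F 0 s| ≤ C) (hβ : β ∈ Set.Ico (0 : ℝ) 1) :
    ∃! V, IsDiscountedValue F β V :=
  let ⟨V, hV⟩ := hF.exists_isDiscountedValue h0 hβ
  ⟨V, hV, fun _ hU => hU.unique hV hF hβ⟩

end Discounted

section VanishingDiscount

variable {S : Type*} {F : (S → ℝ) → S → ℝ} {g : ℝ}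

/-- The discounted values of `F` have a uniformly bounded oscillation as `β → 1`. -/
def HasBoundedOscillation (F : (S → ℝ) → S → ℝ) : Prop :=
  ∃ C, ∀ᶠ β in 𝓝[<] (1 : ℝ), ∀ V, IsDiscountedValue F β V → ∀ s s', V s ≤ V s' + C

/-- `g` is the gain of `F`: up to a uniformly bounded error, the discounted values of `F` are equal
to `g / (1 - β)` as `β → 1`. -/
def IsGain (F : (S → ℝ) → S → ℝ) (g : ℝ) : Prop :=
  ∃ C, ∀ᶠ β in 𝓝[<] (1 : ℝ), ∀ V, IsDiscountedValue F β V →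
    ∀ s, |(1 - β) * V s - g| ≤ (1 - β) * C

theorem eventually_mem_Ico_nhdsLT_one : ∀ᶠ β in 𝓝[<] (1 : ℝ), β ∈ Set.Ico (0 : ℝ) 1 :=
  Ico_mem_nhdsLT zero_lt_one

theorem tendsto_one_sub_mul_nhdsLT_one (C : ℝ) :
    Tendsto (fun β => (1 - β) * C) (𝓝[<] (1 : ℝ)) (𝓝 0) :=
  (Continuous.tendsto' (by fun_prop) _ _ (by simp)).mono_left nhdsWithin_le_nhds

theorem HasBoundedOscillation.exists_isGain [Nonempty S] (hosc : HasBoundedOscillation F)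
    (hF : IsTopical F) (h0 : ∃ C, ∀ s, |F 0 s| ≤ C) : ∃ g, IsGain F g := by
  obtain ⟨C, hC⟩ := hosc
  have hC := hC.and eventually_mem_Ico_nhdsLT_one
  obtain ⟨β₀, hCβ₀, hβ₀⟩ := hC.exists
  obtain ⟨V₀, hV₀⟩ := hF.isSubtopical.exists_isDiscountedValue h0 hβ₀
  let family : Set (ℝ × (S → ℝ) × S) := {x | IsDiscountedValue F x.1 x.2.1 ∧ x.1 < 1 ∧
    ∀ s s', x.2.1 s ≤ x.2.1 s' + C}
  have hne : family.Nonempty := ⟨(β₀, V₀, Classical.arbitrary S), hV₀, hβ₀.2, hCβ₀ V₀ hV₀⟩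
  obtain ⟨g, hg, hg'⟩ := exists_between_of_forall_le
    (hne.image fun x => (1 - x.1) * (x.2.1 x.2.2 - C))
    (hne.image fun x => (1 - x.1) * (x.2.1 x.2.2 + C)) <| by
      rintro _ ⟨⟨β, V, s⟩, ⟨hV, hβ, hVC⟩, rfl⟩ _ ⟨⟨β', V', s'⟩, ⟨hV', hβ', hVC'⟩, rfl⟩
      exact hV.le_of_le_one_sub_mul hV' hF
        (fun t => mul_le_mul_of_nonneg_left (sub_le_iff_le_add.2 (hVC s t)) (sub_pos.2 hβ).le)
        (fun t => mul_le_mul_of_nonneg_left (hVC' t s') (sub_pos.2 hβ').le)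
  refine ⟨g, C, hC.mono fun β ⟨hCβ, hβ⟩ V hV s => ?_⟩
  have hmem : (β, V, s) ∈ family := ⟨hV, hβ.2, hCβ V hV⟩
  have hlow := hg ⟨_, hmem, rfl⟩
  have hupp := hg' ⟨_, hmem, rfl⟩
  exact abs_le.2 ⟨by linarith, by linarith⟩

theorem IsGain.tendsto (hg : IsGain F g) {V : ℝ → S → ℝ}
    (hV : ∀ β ∈ Set.Ico (0 : ℝ) 1, IsDiscountedValue F β (V β)) (s : S) :
    Tendsto (fun β => (1 - β) * V β s) (𝓝[<] 1) (𝓝 g) := by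
  obtain ⟨C, hC⟩ := hg
  rw [tendsto_iff_norm_sub_tendsto_zero]
  refine squeeze_zero' (Eventually.of_forall fun _ => norm_nonneg _) ?_
    (tendsto_one_sub_mul_nhdsLT_one C)
  filter_upwards [hC, eventually_mem_Ico_nhdsLT_one] with β hCβ hβ
  exact hCβ _ (hV β hβ) s

theorem le_of_tendsto_one_sub_mul {G : (S → ℝ) → S → ℝ} (hG : IsSubtopical G) (hFG : F ≤ G)
    {V U : ℝ → S → ℝ} (hV : ∀ β ∈ Set.Ico (0 : ℝ) 1, IsDiscountedValue F β (V β))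
    (hU : ∀ β ∈ Set.Ico (0 : ℝ) 1, IsDiscountedValue G β (U β)) {s : S} {a b : ℝ}
    (ha : Tendsto (fun β => (1 - β) * V β s) (𝓝[<] 1) (𝓝 a))
    (hb : Tendsto (fun β => (1 - β) * U β s) (𝓝[<] 1) (𝓝 b)) : a ≤ b := by
  refine le_of_tendsto_of_tendsto ha hb ?_
  filter_upwards [eventually_mem_Ico_nhdsLT_one] with β hβ
  exact mul_le_mul_of_nonneg_left ((hV β hβ).mono (hU β hβ) hG hβ hFG s) (sub_pos.2 hβ.2).le

end VanishingDiscount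

section NonlinearExpectation

variable {ι S : Type*} {Φ : (ι → ℝ) → S → ℝ} {v : ι → ℝ} {c : ℝ}

/-- Nonlinear expectations: topical maps `Φ` with `Φ 0 = 0`. Here `Φ v s` is the evaluation, in the
state `s`, of the uncertain gain `v`. -/
structure IsNonlinearExpectation (Φ : (ι → ℝ) → S → ℝ) : Prop where
  isTopical : IsTopical Φ
  map_zero : Φ 0 = 0

theorem IsNonlinearExpectation.apply_le (hΦ : IsNonlinearExpectation Φ) (h : ∀ i, v i ≤ c)
    (s : S) : Φ v s ≤ c := by
  simpa [hΦ.map_zero] using hΦ.isTopical (V := 0) (c := c) (by simpa using h) s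

theorem IsNonlinearExpectation.le_apply (hΦ : IsNonlinearExpectation Φ) (h : ∀ i, c ≤ v i)
    (s : S) : c ≤ Φ v s := by
  simpa [hΦ.map_zero] using hΦ.isTopical (U := 0) (V := v) (c := -c) (by simpa using h) s

/-- The linear expectation in which, in the state `s`, the outcome `i` has probability `ρ s i`. -/
def expectation [Fintype ι] (ρ : S → ι → ℝ) (v : ι → ℝ) (s : S) : ℝ := ρ s ⬝ᵥ v

/-- The nonlinear expectation in which the best outcome occurs. -/
def bestCase (v : ι → ℝ) (_ : S) : ℝ := ⨆ i, v i

/-- The nonlinear expectation in which the worst outcome occurs. -/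
def worstCase (v : ι → ℝ) (_ : S) : ℝ := ⨅ i, v i

theorem isNonlinearExpectation_expectation [Fintype ι] {ρ : S → ι → ℝ}
    (hρ : ∀ s, ρ s ∈ stdSimplex ℝ ι) :
    IsNonlinearExpectation (expectation ρ) where
  isTopical U V c h s := by
    calc ρ s ⬝ᵥ U ≤ ρ s ⬝ᵥ (V + fun _ => c) := dotProduct_le_dotProduct_of_nonneg_left h (hρ s).1
      _ = ρ s ⬝ᵥ V + c := by
        rw [dotProduct_add, dotProduct, dotProduct, ← Finset.sum_mul, (hρ s).2, one_mul]
  map_zero := funext fun s => dotProduct_zero (ρ s)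

variable [Finite ι]

theorem isNonlinearExpectation_bestCase [Nonempty ι] :
    IsNonlinearExpectation (bestCase (ι := ι) (S := S)) where
  isTopical _ _ _ h _ := ciSup_le fun i =>
    (h i).trans (add_le_add_left (le_ciSup (Set.finite_range _).bddAbove i) _)
  map_zero := funext fun _ => ciSup_const

theorem isNonlinearExpectation_worstCase [Nonempty ι] :
    IsNonlinearExpectation (worstCase (ι := ι) (S := S)) where
  isTopical _ _ _ h _ := sub_le_iff_le_add.1 <| le_ciInf fun i =>
    sub_le_iff_le_add.2 ((ciInf_le (Set.finite_range _).bddBelow i).trans (h i))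
  map_zero := funext fun _ => ciInf_const

theorem IsNonlinearExpectation.le_bestCase (hΦ : IsNonlinearExpectation Φ) : Φ ≤ bestCase :=
  fun v => hΦ.apply_le fun i => le_ciSup (Set.finite_range v).bddAbove i

theorem IsNonlinearExpectation.worstCase_le (hΦ : IsNonlinearExpectation Φ) : worstCase ≤ Φ :=
  fun v => hΦ.le_apply fun i => ciInf_le (Set.finite_range v).bddBelow i

end NonlinearExpectation

section Bellman

variable {ι : Type*} {Φ Ψ : (ι → ℝ) → ι × ℕ+ → ℝ} {r : ι → ℕ+ → ℝ} {R B β : ℝ}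
  {V : ι × ℕ+ → ℝ}

/-- The undiscounted Bellman operator of the arms `ι`: being passive in the state `(j, τ)` earns
`r j τ` and leads to `(j, τ + 1)`, being active earns `R` and leads to a state `(i, 1)`, where the
uncertainty about `i` is evaluated by `Φ`. -/
def bellman (Φ : (ι → ℝ) → ι × ℕ+ → ℝ) (r : ι → ℕ+ → ℝ) (R : ℝ) (V : ι × ℕ+ → ℝ) (s : ι × ℕ+) : ℝ :=
  max (r s.1 s.2 + V (s.1, s.2 + 1)) (R + Φ (fun i => V (i, 1)) s)

theorem isTopical_bellman (hΦ : IsTopical Φ) : IsTopical (bellman Φ r R) := fun U V c h s => by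
  have hΦs := hΦ (U := fun i => U (i, 1)) (V := fun i => V (i, 1)) (fun i => h (i, 1)) s
  rw [bellman, bellman, ← max_add_add_right]
  exact max_le_max (by linarith [h (s.1, s.2 + 1)]) (by linarith)

theorem bellman_mono (h : Φ ≤ Ψ) : bellman Φ r R ≤ bellman Ψ r R := fun _ s =>
  max_le_max le_rfl (add_le_add_right (h _ s) R)

theorem exists_forall_le_of_antitone [Finite ι] (hr : ∀ j, Antitone (r j)) (R : ℝ) :
    ∃ B, R ≤ B ∧ ∀ j τ, r j τ ≤ B := by
  obtain ⟨M, hM⟩ := Finite.exists_le fun j => r j 1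
  exact ⟨max R M, le_max_left R M, fun j τ =>
    (hr j one_le).trans ((hM j).trans (le_max_right R M))⟩

theorem le_bellman_zero (hΦ : IsNonlinearExpectation Φ) (s : ι × ℕ+) : R ≤ bellman Φ r R 0 s :=
  le_max_of_le_right (le_add_of_nonneg_right (hΦ.le_apply (fun _ => le_rfl) s))

theorem bellman_zero_le (hΦ : IsNonlinearExpectation Φ) (hRB : R ≤ B) (hrB : ∀ j τ, r j τ ≤ B)
    (s : ι × ℕ+) : bellman Φ r R 0 s ≤ B :=
  max_le ((add_zero _).trans_le (hrB _ _))
    ((add_le_of_nonpos_right (hΦ.apply_le (fun _ => le_rfl) s)).trans hRB)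

theorem exists_abs_bellman_zero_le [Finite ι] (hΦ : IsNonlinearExpectation Φ)
    (hr : ∀ j, Antitone (r j)) (R : ℝ) : ∃ C, ∀ s, |bellman Φ r R 0 s| ≤ C :=
  let ⟨_, hRB, hrB⟩ := exists_forall_le_of_antitone hr R
  ⟨_, fun s => abs_le_max_abs_abs (le_bellman_zero hΦ s) (bellman_zero_le hΦ hRB hrB s)⟩

theorem existsUnique_isDiscountedValue_bellman [Finite ι] (hΦ : IsNonlinearExpectation Φ)
    (hr : ∀ j, Antitone (r j)) (hβ : β ∈ Set.Ico (0 : ℝ) 1) :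
    ∃! V, IsDiscountedValue (bellman Φ r R) β V :=
  (isTopical_bellman hΦ.isTopical).isSubtopical.existsUnique_isDiscountedValue
    (exists_abs_bellman_zero_le hΦ hr R) hβ

namespace IsDiscountedValue

theorem bellman_one_sub_mul_le (hV : IsDiscountedValue (bellman Φ r R) β V)
    (hΦ : IsNonlinearExpectation Φ) (hβ : β ∈ Set.Ico (0 : ℝ) 1) (hRB : R ≤ B)
    (hrB : ∀ j τ, r j τ ≤ B) (s : ι × ℕ+) : (1 - β) * V s ≤ B :=
  hV.one_sub_mul_le (isTopical_bellman hΦ.isTopical) hβ (bellman_zero_le hΦ hRB hrB) s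

theorem bellman_le_one_sub_mul (hV : IsDiscountedValue (bellman Φ r R) β V)
    (hΦ : IsNonlinearExpectation Φ) (hβ : β ∈ Set.Ico (0 : ℝ) 1) (s : ι × ℕ+) :
    R ≤ (1 - β) * V s :=
  hV.le_one_sub_mul (isTopical_bellman hΦ.isTopical) hβ (le_bellman_zero hΦ) s

theorem bellman_active_le (hV : IsDiscountedValue (bellman Φ r R) β V) (s : ι × ℕ+) :
    R + Φ (fun i => β * V (i, 1)) s ≤ V s :=
  (le_max_right _ _).trans (congrFun hV.eq_apply s).ge

end IsDiscountedValue

theorem le_of_tendsto_one_sub_mul_bellman (hΦ : IsNonlinearExpectation Φ) {V : ℝ → ι × ℕ+ → ℝ}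
    (hV : ∀ β ∈ Set.Ico (0 : ℝ) 1, IsDiscountedValue (bellman Φ r R) β (V β)) {s : ι × ℕ+} {a : ℝ}
    (ha : Tendsto (fun β => (1 - β) * V β s) (𝓝[<] 1) (𝓝 a)) : R ≤ a :=
  ge_of_tendsto ha (eventually_mem_Ico_nhdsLT_one.mono fun β hβ =>
    (hV β hβ).bellman_le_one_sub_mul hΦ hβ s)

end Bellman

section Stopping

variable {r p : ℕ+ → ℝ} {β C μ : ℝ} {x : ℕ+ → ℝ}

/-- The undiscounted Bellman operator of an optimal stopping problem: continuing at age `τ` earns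
`r τ`, stopping at age `τ` earns `p τ`. -/
def stopping (r p x : ℕ+ → ℝ) (τ : ℕ+) : ℝ := max (r τ + x (τ + 1)) (p τ)

theorem isSubtopical_stopping : IsSubtopical (stopping r p) := fun U V c hc h τ => by
  rw [stopping, stopping, ← max_add_add_right]
  exact max_le_max (by linarith [h (τ + 1)]) (by linarith)

namespace IsDiscountedValue

theorem stopping_apply (hx : IsDiscountedValue (stopping r p) β x) (τ : ℕ+) :
    x τ = max (r τ + β * x (τ + 1)) (p τ) :=
  congrFun hx.eq_apply τ

theorem stopping_add_le (hx : IsDiscountedValue (stopping r p) β x) (hβ : β ∈ Set.Ico (0 : ℝ) 1)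
    (hr : Antitone r) (hC : 0 ≤ C) (hp : ∀ τ τ', p τ' ≤ p τ + C) (τ σ : ℕ+) :
    x (τ + σ) ≤ x τ + C := by
  obtain ⟨A, hA⟩ := hx.bddAbove
  obtain ⟨A', hA'⟩ := hx.bddBelow
  refine isSubtopical_stopping.le_of_le_apply_of_apply_le (F := stopping r fun τ => p τ + C) hβ
    (U := fun τ => x (τ + σ)) (V := fun τ => x τ + C)
    ⟨A, Set.forall_mem_range.2 fun τ => hA ⟨τ + σ, rfl⟩⟩
    ⟨A' + C, Set.forall_mem_range.2 fun τ => add_le_add_left (hA' ⟨τ, rfl⟩) C⟩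
    (fun τ => ?_) (fun τ => ?_) τ
  · refine (hx.stopping_apply (τ + σ)).le.trans ?_
    rw [add_right_comm]
    exact max_le_max (add_le_add_left (hr (PNat.lt_add_right τ σ).le) _) (hp τ (τ + σ))
  · refine max_le ?_ (add_le_add_left ((le_max_right _ _).trans_eq (hx.stopping_apply τ).symm) C)
    have hpass := (le_max_left _ _).trans_eq (hx.stopping_apply τ).symm
    have hβC := mul_le_of_le_one_left hC hβ.2.le
    simp only [Pi.smul_apply, smul_eq_mul]
    linarith

theorem le_one_sub_mul_stopping (hx : IsDiscountedValue (stopping r p) β x)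
    (hβ : β ∈ Set.Ico (0 : ℝ) 1) {l : ℝ} (hl : ∀ τ, l ≤ max (r τ) ((1 - β) * p τ)) (τ : ℕ+) :
    l ≤ (1 - β) * x τ := by
  have hβ' := sub_pos.2 hβ.2
  refine (div_le_iff₀' hβ').1 ?_
  refine hx.le_of_le_apply isSubtopical_stopping hβ (U := fun _ => l / (1 - β))
    ⟨_, by rintro _ ⟨_, rfl⟩; rfl⟩ (fun τ => ?_) τ
  exact (le_max_iff.1 (hl τ)).elim
    (fun hr => le_max_of_le_left ((add_mul_div_one_sub hβ.2 l).ge.trans (add_le_add_left hr _)))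
    (fun hp => le_max_of_le_right ((div_le_iff₀' hβ').2 hp))

theorem one_sub_mul_stopping_le (hx : IsDiscountedValue (stopping r p) β x)
    (hβ : β ∈ Set.Ico (0 : ℝ) 1) {τ : ℕ+} (hxτ : x (τ + 1) ≤ x τ) :
    (1 - β) * x τ ≤ max (r τ) ((1 - β) * p τ) := by
  refine (le_max_iff.1 (hx.stopping_apply τ).le).elim (fun h => le_max_of_le_left ?_) fun h =>
    le_max_of_le_right (mul_le_mul_of_nonneg_left h (sub_pos.2 hβ.2).le)
  linarith [mul_le_mul_of_nonneg_left hxτ hβ.1]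

theorem stopping_le_add_mul (hx : IsDiscountedValue (stopping r p) β x) {D : ℝ} (hD : 0 ≤ D)
    (hrD : ∀ τ, r τ - (1 - β) * x (τ + 1) ≤ D) (hp : ∀ τ, p τ ≤ x (τ + 1)) (τ σ : ℕ+) :
    x τ ≤ x (τ + σ) + σ * D := by
  have hstep : ∀ τ, x τ ≤ x (τ + 1) + D := fun τ =>
    (hx.stopping_apply τ).le.trans (max_le (by linarith [hrD τ]) (by linarith [hp τ]))
  induction σ using PNat.recOn with
  | one => simpa using hstep τ
  | succ σ ih =>
    rw [PNat.add_coe, PNat.one_coe, ← add_assoc]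
    push_cast
    linarith [hstep (τ + σ)]

theorem stopping_const_le (hx : IsDiscountedValue (stopping r fun _ => μ) β x)
    (hβ : β ∈ Set.Ico (0 : ℝ) 1) (hr : Antitone r) {l : ℝ} (hl : l ≤ (1 - β) * μ) (τ σ : ℕ+) :
    (1 - β) * x τ ≤ max (r σ) ((1 - β) * μ) + (1 - β) * (σ * max (r 1 - l) 0) := by
  have hμx : ∀ τ, μ ≤ x τ := fun τ => (le_max_right _ _).trans_eq (hx.stopping_apply τ).symm
  have hanti : ∀ τ σ, x (τ + σ) ≤ x τ := fun τ σ => by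
    simpa using hx.stopping_add_le hβ hr le_rfl (by simp) τ σ
  have htele := hx.stopping_le_add_mul (D := max (r 1 - l) 0) (le_max_right _ _)
    (fun τ => le_max_of_le_left <| sub_le_sub (hr one_le) <|
      hl.trans (mul_le_mul_of_nonneg_left (hμx _) (sub_pos.2 hβ.2).le))
    (fun τ => hμx (τ + 1)) τ σ
  calc (1 - β) * x τ ≤ (1 - β) * (x σ + σ * max (r 1 - l) 0) := by
        have := hanti σ τ
        rw [add_comm] at this
        exact mul_le_mul_of_nonneg_left (by linarith) (sub_pos.2 hβ.2).le
    _ ≤ _ := by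
        rw [mul_add]
        exact add_le_add_left (hx.one_sub_mul_stopping_le hβ (hanti σ 1)) _

end IsDiscountedValue

/-- Continuing up to the age `N` and then stopping, or for ever, costs only finitely many slots, so
that in the limit only the final regime counts. -/
theorem tendsto_one_sub_mul_stopping (hr : Antitone r) {p : ℝ → ℝ} {x : ℝ → ℕ+ → ℝ}
    (hx : ∀ β ∈ Set.Ico (0 : ℝ) 1, IsDiscountedValue (stopping r fun _ => p β) β (x β))
    (hp : Tendsto (fun β => (1 - β) * p β) (𝓝[<] 1) (𝓝 μ)) (τ : ℕ+) :
    Tendsto (fun β => (1 - β) * x β τ) (𝓝[<] 1) (𝓝 (⨅ N, max (r N) μ)) := by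
  have hbdd : BddBelow (Set.range fun N => max (r N) μ) :=
    ⟨μ, Set.forall_mem_range.2 fun N => le_max_right _ _⟩
  refine tendsto_order.2 ⟨fun a ha => ?_, fun b hb => ?_⟩
  · have hlow : Tendsto (fun β => (⨅ N, max (r N) μ) - |(1 - β) * p β - μ|) (𝓝[<] 1)
        (𝓝 (⨅ N, max (r N) μ)) := by
      simpa using (hp.sub_const μ).abs.const_sub (⨅ N, max (r N) μ)
    filter_upwards [hlow.eventually (lt_mem_nhds ha), eventually_mem_Ico_nhdsLT_one] with β haβ hβ
    refine haβ.trans_le ((hx β hβ).le_one_sub_mul_stopping hβ (fun N => ?_) τ)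
    rw [sub_le_iff_le_add, ← max_add_add_right]
    exact (ciInf_le hbdd N).trans (max_le_max (by linarith [abs_nonneg ((1 - β) * p β - μ)])
      (by linarith [neg_abs_le ((1 - β) * p β - μ)]))
  · obtain ⟨N, hN⟩ := exists_lt_of_ciInf_lt hb
    have hupp : Tendsto (fun β => max (r N) ((1 - β) * p β) +
        (1 - β) * (N * max (r 1 - (μ - 1)) 0)) (𝓝[<] 1) (𝓝 (max (r N) μ)) := by
      simpa using (tendsto_const_nhds.max hp).add (tendsto_one_sub_mul_nhdsLT_one _)
    filter_upwards [hupp.eventually (gt_mem_nhds hN), eventually_mem_Ico_nhdsLT_one,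
      hp.eventually (lt_mem_nhds (sub_one_lt μ))] with β hbβ hβ hpβ
    exact ((hx β hβ).stopping_const_le hβ hr hpβ.le τ N).trans_lt hbβ

end Stopping

section Oscillation

variable {ι : Type*} {Φ : (ι → ℝ) → ι × ℕ+ → ℝ} {r : ι → ℕ+ → ℝ} {R B C β : ℝ} {V : ι × ℕ+ → ℝ}

namespace IsDiscountedValue

theorem bellman_arm (hV : IsDiscountedValue (bellman Φ r R) β V) (j : ι) :
    IsDiscountedValue (stopping (r j) fun τ => R + Φ (fun i => β * V (i, 1)) (j, τ)) β
      fun τ => V (j, τ) where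
  bounded := hV.bounded.imp fun _ h τ => h (j, τ)
  eq_apply := funext fun τ => congrFun hV.eq_apply (j, τ)

theorem bellman_le_fresh_add (hV : IsDiscountedValue (bellman Φ r R) β V)
    (hΦ : IsNonlinearExpectation Φ) (hβ : β ∈ Set.Ico (0 : ℝ) 1) (hr : ∀ j, Antitone (r j))
    (hC : ∀ i k, V (k, 1) ≤ V (i, 1) + C) (s : ι × ℕ+) : V s ≤ V (s.1, 1) + C := by
  obtain ⟨j, τ⟩ := s
  have hC0 : 0 ≤ C := by linarith [hC j j]
  have hβC : ∀ i k, β * V (k, 1) ≤ β * V (i, 1) + C := fun i k => by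
    linarith [mul_le_mul_of_nonneg_left (hC i k) hβ.1, mul_le_of_le_one_left hC0 hβ.2.le]
  obtain rfl | hτ := eq_or_ne τ 1
  · exact le_add_of_nonneg_right hC0
  obtain ⟨σ, rfl⟩ := PNat.exists_eq_succ_of_ne_one hτ
  rw [add_comm σ]
  refine (hV.bellman_arm j).stopping_add_le hβ (hr j) hC0 (fun τ τ' => ?_) 1 σ
  rw [add_assoc]
  refine add_le_add_right (hΦ.apply_le (fun k => sub_le_iff_le_add.1 ?_) _) R
  exact hΦ.le_apply (fun i => sub_le_iff_le_add.2 (hβC i k)) _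

theorem bellman_fresh_le_add (hV : IsDiscountedValue (bellman Φ r R) β V)
    (hΦ : IsNonlinearExpectation Φ) (hβ : β ∈ Set.Ico (0 : ℝ) 1) (hRB : R ≤ B)
    (hrB : ∀ j τ, r j τ ≤ B) (hC : ∀ i k, V (k, 1) ≤ V (i, 1) + C) (k : ι) (s : ι × ℕ+) :
    V (k, 1) ≤ V s + C + (B - R) := by
  have hC0 : 0 ≤ C := by linarith [hC k k]
  have hΦk : β * (V (k, 1) - C) ≤ Φ (fun i => β * V (i, 1)) s := hΦ.le_apply (fun i =>
    mul_le_mul_of_nonneg_left (sub_le_iff_le_add.2 (hC i k)) hβ.1) s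
  linarith [hV.bellman_active_le s, hV.bellman_one_sub_mul_le hΦ hβ hRB hrB (k, 1),
    mul_le_of_le_one_left hC0 hβ.2.le]

theorem bellman_le_add (hV : IsDiscountedValue (bellman Φ r R) β V)
    (hΦ : IsNonlinearExpectation Φ) (hβ : β ∈ Set.Ico (0 : ℝ) 1) (hr : ∀ j, Antitone (r j))
    (hRB : R ≤ B) (hrB : ∀ j τ, r j τ ≤ B) (hC : ∀ i k, V (k, 1) ≤ V (i, 1) + C)
    (s s' : ι × ℕ+) : V s ≤ V s' + (2 * C + (B - R)) := by
  linarith [hV.bellman_le_fresh_add hΦ hβ hr hC s, hV.bellman_fresh_le_add hΦ hβ hRB hrB hC s.1 s']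

end IsDiscountedValue

theorem hasBoundedOscillation_bellman [Finite ι] (hΦ : IsNonlinearExpectation Φ)
    (hr : ∀ j, Antitone (r j))
    (hC : ∃ C, ∀ᶠ β in 𝓝[<] (1 : ℝ), ∀ V, IsDiscountedValue (bellman Φ r R) β V →
      ∀ i k, V (k, 1) ≤ V (i, 1) + C) : HasBoundedOscillation (bellman Φ r R) := by
  obtain ⟨C, hC⟩ := hC
  obtain ⟨B, hRB, hrB⟩ := exists_forall_le_of_antitone hr R
  refine ⟨2 * C + (B - R), ?_⟩
  filter_upwards [hC, eventually_mem_Ico_nhdsLT_one] with β hCβ hβ V hV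
  exact hV.bellman_le_add hΦ hβ hr hRB hrB (hCβ V hV)

theorem hasBoundedOscillation_bellman_bestCase [Finite ι] [Nonempty ι]
    (hr : ∀ j, Antitone (r j)) : HasBoundedOscillation (bellman bestCase r R) := by
  have hΦ := isNonlinearExpectation_bestCase (ι := ι) (S := ι × ℕ+)
  obtain ⟨B, hRB, hrB⟩ := exists_forall_le_of_antitone hr R
  refine hasBoundedOscillation_bellman hΦ hr ⟨B - R, ?_⟩
  filter_upwards [eventually_mem_Ico_nhdsLT_one] with β hβ V hV i k
  have hbest : β * V (k, 1) ≤ bestCase (fun i => β * V (i, 1)) (i, (1 : ℕ+)) :=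
    le_ciSup (f := fun i => β * V (i, 1)) (Set.finite_range _).bddAbove k
  linarith [hV.bellman_active_le (i, 1), hV.bellman_one_sub_mul_le hΦ hβ hRB hrB (k, 1)]

theorem exists_isGain_bellman_bestCase [Finite ι] [Nonempty ι] (hr : ∀ j, Antitone (r j)) (R : ℝ) :
    ∃ g, IsGain (bellman bestCase r R) g :=
  (hasBoundedOscillation_bellman_bestCase hr).exists_isGain
    (isTopical_bellman isNonlinearExpectation_bestCase.isTopical)
    (exists_abs_bellman_zero_le isNonlinearExpectation_bestCase hr R)

end Oscillation

section Irreducible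

/-- The transition matrix of the last observed channel state when the user is always active. -/
def activeMatrix {ι : Type*} (ρ : ι × ℕ+ → ι → ℝ) : Matrix ι ι ℝ := Matrix.of fun i => ρ (i, 1)

variable {ι : Type*} [Fintype ι]

section DecidableEq

variable [DecidableEq ι]

theorem add_pow_mulVec_le {Q : Matrix ι ι ℝ} (hQ : Q ∈ rowStochastic ℝ ι) {β R : ℝ} (hβ : 0 ≤ β)
    {v : ι → ℝ} (h : ∀ i, R + β * (Q *ᵥ v) i ≤ v i) (n : ℕ) (i : ι) :
    R * ∑ t ∈ Finset.range n, β ^ t + β ^ n * (Q ^ n *ᵥ v) i ≤ v i := by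
  induction n with
  | zero => simp
  | succ n ih =>
    have hE := isNonlinearExpectation_expectation (ρ := Q ^ n) fun i =>
      ⟨fun k => nonneg_of_mem_rowStochastic (pow_mem hQ n),
        sum_row_of_mem_rowStochastic (pow_mem hQ n) i⟩
    have hQn : β * (Q ^ (n + 1) *ᵥ v) i ≤ (Q ^ n *ᵥ v) i + -R := by
      rw [pow_succ, ← mulVec_mulVec, ← smul_eq_mul, ← Pi.smul_apply, ← mulVec_smul]
      exact hE.isTopical (fun k => le_add_neg_iff_add_le.2 ((add_comm _ _).trans_le (h k))) i
    rw [Finset.sum_range_succ, pow_succ, mul_assoc]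
    linarith [mul_le_mul_of_nonneg_left hQn (pow_nonneg hβ n)]

theorem apply_mul_sub_le_mulVec_sub {Q : Matrix ι ι ℝ} (hQ : Q ∈ rowStochastic ℝ ι) {v : ι → ℝ}
    {l : ι} (hl : ∀ i, v l ≤ v i) (k : ι) : Q l k * (v k - v l) ≤ (Q *ᵥ v) l - v l :=
  calc Q l k * (v k - v l) ≤ ∑ i, Q l i * (v i - v l) :=
        Finset.single_le_sum (f := fun i => Q l i * (v i - v l))
          (fun i _ => mul_nonneg (nonneg_of_mem_rowStochastic hQ) (sub_nonneg.2 (hl i)))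
          (Finset.mem_univ k)
    _ = (Q *ᵥ v) l - v l := by
        simp only [mul_sub, Finset.sum_sub_distrib, ← Finset.sum_mul,
          sum_row_of_mem_rowStochastic hQ, one_mul, mulVec, dotProduct]

theorem pow_mul_apply_mul_sub_le {Q : Matrix ι ι ℝ} (hQ : Q ∈ rowStochastic ℝ ι) {β R B : ℝ}
    (hβ : β ∈ Set.Ico (0 : ℝ) 1) {v : ι → ℝ} (h : ∀ i, R + β * (Q *ᵥ v) i ≤ v i) {l : ι}
    (hl : ∀ i, v l ≤ v i) (hRB : R ≤ B) (hB : (1 - β) * v l ≤ B) (n : ℕ) (k : ι) :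
    β ^ n * ((Q ^ n) l k * (v k - v l)) ≤ n * (B - R) := by
  have hsum : ∑ t ∈ Finset.range n, β ^ t ≤ n := by
    simpa using Finset.sum_le_card_nsmul (Finset.range n) (fun t => β ^ t) 1
      fun t _ => pow_le_one₀ hβ.1 hβ.2.le
  calc β ^ n * ((Q ^ n) l k * (v k - v l)) ≤ β ^ n * ((Q ^ n *ᵥ v) l - v l) :=
        mul_le_mul_of_nonneg_left (apply_mul_sub_le_mulVec_sub (pow_mem hQ n) hl k)
          (pow_nonneg hβ.1 n)
    _ ≤ (1 - β ^ n) * v l - R * ∑ t ∈ Finset.range n, β ^ t := by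
        linarith [add_pow_mulVec_le hQ hβ.1 h n l]
    _ = (∑ t ∈ Finset.range n, β ^ t) * ((1 - β) * v l - R) := by
        rw [← mul_neg_geom_sum]
        ring
    _ ≤ (∑ t ∈ Finset.range n, β ^ t) * (B - R) :=
        mul_le_mul_of_nonneg_left (sub_le_sub_right hB R)
          (Finset.sum_nonneg fun t _ => pow_nonneg hβ.1 t)
    _ ≤ n * (B - R) := mul_le_mul_of_nonneg_right hsum (sub_nonneg.2 hRB)

theorem exists_forall_le_add_of_isIrreducible [Nonempty ι] {Q : Matrix ι ι ℝ}
    (hQ : Q ∈ rowStochastic ℝ ι) (hirr : Q.IsIrreducible) {R B : ℝ} (hRB : R ≤ B) :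
    ∃ C, ∀ β ∈ Set.Ico (1 / 2 : ℝ) 1, ∀ v : ι → ℝ, (∀ i, R + β * (Q *ᵥ v) i ≤ v i) →
      (∀ i, (1 - β) * v i ≤ B) → ∀ i k, v k ≤ v i + C := by
  choose n _ hn using (isIrreducible_iff_exists_pow_pos hirr.nonneg).1 hirr
  obtain ⟨C, hC⟩ := Finite.exists_le fun x : ι × ι =>
    n x.1 x.2 * (B - R) / ((1 / 2) ^ n x.1 x.2 * (Q ^ n x.1 x.2) x.1 x.2)
  refine ⟨C, fun β hβ v hsuper hB i k => ?_⟩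
  obtain ⟨l, hl⟩ := Finite.exists_min v
  have hβ0 : β ∈ Set.Ico (0 : ℝ) 1 := ⟨(by norm_num : (0 : ℝ) ≤ 1 / 2).trans hβ.1, hβ.2⟩
  have hkl : (1 / 2) ^ n l k * (Q ^ n l k) l k * (v k - v l) ≤ n l k * (B - R) := by
    refine le_trans ?_ (pow_mul_apply_mul_sub_le hQ hβ0 hsuper hl hRB (hB l) (n l k) k)
    rw [mul_assoc]
    exact mul_le_mul_of_nonneg_right (pow_le_pow_left₀ (by norm_num) hβ.1 _)
      (mul_nonneg (hn l k).le (sub_nonneg.2 (hl k)))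
  have hCkl := ((le_div_iff₀' (mul_pos (by positivity) (hn l k))).2 hkl).trans (hC (l, k))
  linarith [hl i]

theorem activeMatrix_mem_rowStochastic {ρ : ι × ℕ+ → ι → ℝ} (hρ : ∀ s, ρ s ∈ stdSimplex ℝ ι) :
    activeMatrix ρ ∈ rowStochastic ℝ ι :=
  mem_rowStochastic_iff_sum.2 ⟨fun _ => (hρ _).1, fun _ => (hρ _).2⟩

end DecidableEq

theorem hasBoundedOscillation_bellman_expectation [Nonempty ι] {ρ : ι × ℕ+ → ι → ℝ}
    (hρ : ∀ s, ρ s ∈ stdSimplex ℝ ι) (hirr : (activeMatrix ρ).IsIrreducible) {r : ι → ℕ+ → ℝ}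
    (hr : ∀ j, Antitone (r j)) (R : ℝ) :
    HasBoundedOscillation (bellman (expectation ρ) r R) := by
  classical
  have hΦ := isNonlinearExpectation_expectation hρ
  obtain ⟨B, hRB, hrB⟩ := exists_forall_le_of_antitone hr R
  obtain ⟨C, hC⟩ :=
    exists_forall_le_add_of_isIrreducible (activeMatrix_mem_rowStochastic hρ) hirr hRB
  refine hasBoundedOscillation_bellman hΦ hr ⟨C, ?_⟩
  filter_upwards [eventually_mem_Ico_nhdsLT_one, Ico_mem_nhdsLT (by norm_num : (1 / 2 : ℝ) < 1)]
    with β hβ hβ' V hV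
  refine hC β hβ' (fun i => V (i, 1)) (fun i => ?_)
    fun i => hV.bellman_one_sub_mul_le hΦ hβ hRB hrB (i, 1)
  calc R + β * (activeMatrix ρ *ᵥ fun i => V (i, 1)) i
      = R + ρ (i, 1) ⬝ᵥ (β • fun i => V (i, 1)) := by rw [dotProduct_smul]; rfl
    _ ≤ V (i, 1) := hV.bellman_active_le (i, 1)

theorem exists_isGain_bellman_expectation [Nonempty ι] {ρ : ι × ℕ+ → ι → ℝ}
    (hρ : ∀ s, ρ s ∈ stdSimplex ℝ ι) (hirr : (activeMatrix ρ).IsIrreducible) {r : ι → ℕ+ → ℝ}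
    (hr : ∀ j, Antitone (r j)) (R : ℝ) : ∃ g, IsGain (bellman (expectation ρ) r R) g :=
  (hasBoundedOscillation_bellman_expectation hρ hirr hr R).exists_isGain
    (isTopical_bellman (isNonlinearExpectation_expectation hρ).isTopical)
    (exists_abs_bellman_zero_le (isNonlinearExpectation_expectation hρ) hr R)

end Irreducible

section Policies

variable {K : ℕ} {ρ : BeliefState K → Fin K → ℝ} {R0 : Fin K → ℕ+ → ℝ} {R1 W β g G : ℝ}
  {V : BeliefState K → ℝ}

/-- The expected reward when `a` is the present action, `s` the present state and the reward
collected from the next slot on is `f`. -/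
def actionValue (ρ : BeliefState K → Fin K → ℝ) (R0 : Fin K → ℕ+ → ℝ) (R1 W : ℝ) (a : Bool)
    (f : BeliefState K → ℝ) (s : BeliefState K) : ℝ :=
  reward R0 R1 W a s + ∑' s', trans ρ a s s' * f s'

theorem actionValue_false (f : BeliefState K → ℝ) (s : BeliefState K) :
    actionValue ρ R0 R1 W false f s = R0 s.1 s.2 + W + f (s.1, s.2 + 1) :=
  congrArg (reward R0 R1 W false s + ·) (tsum_trans_false ρ s f)

theorem actionValue_true (f : BeliefState K → ℝ) (s : BeliefState K) :
    actionValue ρ R0 R1 W true f s = R1 + expectation ρ (fun i => f (i, 1)) s :=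
  congrArg (reward R0 R1 W true s + ·) (tsum_trans_true ρ s f)

theorem isTopical_actionValue (hρ : ∀ s, ρ s ∈ stdSimplex ℝ (Fin K)) (a : Bool) :
    IsTopical (actionValue ρ R0 R1 W a) := fun U V c h s => by
  cases a
  · rw [actionValue_false, actionValue_false]
    linarith [h (s.1, s.2 + 1)]
  · rw [actionValue_true, actionValue_true]
    linarith [(isNonlinearExpectation_expectation hρ).isTopical (fun i => h (i, 1)) s]

theorem bellman_eq_max_actionValue (f : BeliefState K → ℝ) (s : BeliefState K) :
    bellman (expectation ρ) (fun j τ => R0 j τ + W) R1 f s =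
      max (actionValue ρ R0 R1 W false f s) (actionValue ρ R0 R1 W true f s) := by
  rw [actionValue_false, actionValue_true, bellman]

theorem actionValue_le_bellman (a : Bool) (f : BeliefState K → ℝ) (s : BeliefState K) :
    actionValue ρ R0 R1 W a f s ≤ bellman (expectation ρ) (fun j τ => R0 j τ + W) R1 f s := by
  rw [bellman_eq_max_actionValue]
  cases a
  exacts [le_max_left _ _, le_max_right _ _]

theorem exists_bellman_eq_actionValue (f : BeliefState K → ℝ) (s : BeliefState K) :
    ∃ a, bellman (expectation ρ) (fun j τ => R0 j τ + W) R1 f s = actionValue ρ R0 R1 W a f s := by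
  rw [bellman_eq_max_actionValue]
  exact (max_choice _ _).elim (⟨false, ·⟩) (⟨true, ·⟩)

/-- The expected discounted reward of the first `T` slots, after the past `h`. -/
def partialReward (ρ : BeliefState K → Fin K → ℝ) (R0 : Fin K → ℕ+ → ℝ) (R1 W β : ℝ)
    (φ : Policy K) (T : ℕ) (h : List (BeliefState K)) (s : BeliefState K) : ℝ :=
  ∑ t ∈ Finset.range T, β ^ t * expectedReward ρ R0 R1 W φ t h s

theorem partialReward_succ (φ : Policy K) (T : ℕ) (h : List (BeliefState K)) (s : BeliefState K) :
    partialReward ρ R0 R1 W β φ (T + 1) h s =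
      actionValue ρ R0 R1 W (φ h s) (β • partialReward ρ R0 R1 W β φ T (s :: h)) s := by
  have hsum : ∀ (a : Bool) (f : ℕ → BeliefState K → ℝ),
      ∑' s', trans ρ a s s' * (β • fun s' => ∑ t ∈ Finset.range T, β ^ t * f t s') s' =
        ∑ t ∈ Finset.range T, β ^ (t + 1) * ∑' s', trans ρ a s s' * f t s' := fun a f => by
    cases a
    · simp only [tsum_trans_false]
      simp only [Pi.smul_apply, smul_eq_mul, Finset.mul_sum, pow_succ', mul_assoc]
    · simp only [tsum_trans_true]
      simp only [Pi.smul_apply, smul_eq_mul, Finset.mul_sum]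
      rw [Finset.sum_comm]
      refine Finset.sum_congr rfl fun t _ => Finset.sum_congr rfl fun i _ => ?_
      ring
  rw [partialReward, Finset.sum_range_succ', add_comm, pow_zero, one_mul]
  exact congrArg (reward R0 R1 W (φ h s) s + ·) (hsum (φ h s) _).symm

theorem sum_range_succ_pow_mul_add (β G C : ℝ) (T : ℕ) :
    (∑ t ∈ Finset.range (T + 1), β ^ t) * G + β ^ (T + 1) * C =
      G + β * ((∑ t ∈ Finset.range T, β ^ t) * G + β ^ T * C) := by
  rw [geom_sum_succ, pow_succ]
  ring

theorem partialReward_le (hρ : ∀ s, ρ s ∈ stdSimplex ℝ (Fin K)) (hβ : 0 ≤ β)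
    (hV : ∀ s, bellman (expectation ρ) (fun j τ => R0 j τ + W) R1 (β • V) s ≤ V s + G) {C : ℝ}
    (hC : ∀ s, -C ≤ V s) (φ : Policy K) (T : ℕ) (h : List (BeliefState K)) (s : BeliefState K) :
    partialReward ρ R0 R1 W β φ T h s ≤
      V s + ((∑ t ∈ Finset.range T, β ^ t) * G + β ^ T * C) := by
  induction T generalizing h s with
  | zero => simpa [partialReward] using neg_le_iff_add_nonneg.1 (hC s)
  | succ T ih =>
    have hstep := isTopical_actionValue hρ (φ h s) (R0 := R0) (R1 := R1) (W := W)
      (U := β • partialReward ρ R0 R1 W β φ T (s :: h)) (V := β • V)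
      (fun s' => (mul_le_mul_of_nonneg_left (ih (s :: h) s') hβ).trans_eq (mul_add _ _ _)) s
    rw [partialReward_succ, sum_range_succ_pow_mul_add]
    linarith [actionValue_le_bellman (ρ := ρ) (R0 := R0) (R1 := R1) (W := W) (φ h s) (β • V) s,
      hV s]

theorem le_partialReward (hρ : ∀ s, ρ s ∈ stdSimplex ℝ (Fin K)) (hβ : 0 ≤ β)
    {d : BeliefState K → Bool} (hV : ∀ s, V s + G ≤ actionValue ρ R0 R1 W (d s) (β • V) s) {C : ℝ}
    (hC : ∀ s, V s ≤ -C) (T : ℕ) (h : List (BeliefState K)) (s : BeliefState K) :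
    V s + ((∑ t ∈ Finset.range T, β ^ t) * G + β ^ T * C) ≤
      partialReward ρ R0 R1 W β (fun _ => d) T h s := by
  induction T generalizing h s with
  | zero => simpa [partialReward] using le_neg_iff_add_nonpos_right.1 (hC s)
  | succ T ih =>
    have hstep := isTopical_actionValue hρ (d s) (R0 := R0) (R1 := R1) (W := W)
      (U := β • V) (V := β • partialReward ρ R0 R1 W β (fun _ => d) T (s :: h))
      (fun s' => le_add_neg_iff_add_le.2
        ((mul_add _ _ _).symm.trans_le (mul_le_mul_of_nonneg_left (ih (s :: h) s') hβ))) s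
    rw [partialReward_succ, sum_range_succ_pow_mul_add]
    linarith [hV s]

theorem iSup_liminf_coe_le {ι : Type*} {f : ι → ℕ → ℝ} {u : ℕ → ℝ} {a : ℝ}
    (hfu : ∀ i n, f i n ≤ u n) (hu : Tendsto u atTop (𝓝 a)) :
    ⨆ i, liminf (fun n => (f i n : EReal)) atTop ≤ a :=
  iSup_le fun i => (liminf_le_liminf
    (Eventually.of_forall fun n => EReal.coe_le_coe_iff.2 (hfu i n))).trans_eq
      ((continuous_coe_real_ereal.tendsto a).comp hu).liminf_eq

theorem le_iSup_liminf_coe {ι : Type*} {f : ι → ℕ → ℝ} {u : ℕ → ℝ} {a : ℝ} (i : ι)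
    (huf : ∀ n, u n ≤ f i n) (hu : Tendsto u atTop (𝓝 a)) :
    (a : EReal) ≤ ⨆ i, liminf (fun n => (f i n : EReal)) atTop :=
  le_iSup_of_le i <| ((continuous_coe_real_ereal.tendsto a).comp hu).liminf_eq.symm.trans_le <|
    liminf_le_liminf (Eventually.of_forall fun n => EReal.coe_le_coe_iff.2 (huf n))

theorem IsDiscountedValue.discountedValue_eq
    (hV : IsDiscountedValue (bellman (expectation ρ) (fun j τ => R0 j τ + W) R1) β V)
    (hρ : ∀ s, ρ s ∈ stdSimplex ℝ (Fin K)) (hβ : β ∈ Set.Ico (0 : ℝ) 1) (s : BeliefState K) :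
    discountedValue ρ R0 R1 W β s = (V s : EReal) := by
  obtain ⟨C, hC⟩ := hV.bounded
  have hlim : ∀ C, Tendsto (fun T => V s + ((∑ t ∈ Finset.range T, β ^ t) * 0 + β ^ T * C))
      atTop (𝓝 (V s)) := fun C => by
    simpa using ((tendsto_pow_atTop_nhds_zero_of_lt_one hβ.1 hβ.2).mul_const C).const_add (V s)
  choose d hd using exists_bellman_eq_actionValue (ρ := ρ) (R0 := R0) (R1 := R1) (W := W) (β • V)
  refine le_antisymm (iSup_liminf_coe_le (fun φ T => ?_) (hlim C))
    (le_iSup_liminf_coe (fun _ => d) (fun T => ?_) (hlim (-C)))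
  · exact partialReward_le hρ hβ.1 (fun s => ((congrFun hV.eq_apply s).symm.trans
      (add_zero _).symm).le) (fun s => neg_le_of_abs_le (hC s)) φ T [] s
  · exact le_partialReward hρ hβ.1 (fun s => ((add_zero _).trans
      ((congrFun hV.eq_apply s).trans (hd s))).le)
      (fun s => (le_of_abs_le (hC s)).trans_eq (neg_neg C).symm) T [] s

theorem tendsto_add_mul_add_div (a b G : ℝ) :
    Tendsto (fun T : ℕ => (a + (T * G + b)) / T) atTop (𝓝 G) := by
  have h : Tendsto (fun T : ℕ => (a + b) / (T : ℝ) + G) atTop (𝓝 G) := by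
    simpa using (tendsto_const_div_atTop_nhds_zero_nat (a + b)).add_const G
  refine h.congr' ?_
  filter_upwards [eventually_ne_atTop 0] with T hT
  field_simp
  ring

theorem optimalAverage_le (hρ : ∀ s, ρ s ∈ stdSimplex ℝ (Fin K)) (hb : BddBelow (Set.range V))
    (hV : ∀ s, bellman (expectation ρ) (fun j τ => R0 j τ + W) R1 V s ≤ V s + G)
    (s : BeliefState K) : optimalAverage ρ R0 R1 W s ≤ (G : EReal) := by
  obtain ⟨C, hC⟩ := hb
  refine iSup_liminf_coe_le (fun φ T => div_le_div_of_nonneg_right ?_ (Nat.cast_nonneg T))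
    (tendsto_add_mul_add_div (V s) (-C) G)
  have h := partialReward_le hρ zero_le_one (by simpa only [one_smul] using hV) (C := -C)
    (fun s => (neg_neg C).trans_le (hC ⟨s, rfl⟩)) φ T [] s
  simpa only [partialReward, one_pow, one_mul, Finset.sum_const, Finset.card_range, nsmul_one]
    using h

theorem le_optimalAverage (hρ : ∀ s, ρ s ∈ stdSimplex ℝ (Fin K)) (hb : BddAbove (Set.range V))
    (hV : ∀ s, V s + G ≤ bellman (expectation ρ) (fun j τ => R0 j τ + W) R1 V s)
    (s : BeliefState K) : (G : EReal) ≤ optimalAverage ρ R0 R1 W s := by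
  obtain ⟨C, hC⟩ := hb
  choose d hd using exists_bellman_eq_actionValue (ρ := ρ) (R0 := R0) (R1 := R1) (W := W) V
  refine le_iSup_liminf_coe (fun _ => d)
    (fun T => div_le_div_of_nonneg_right ?_ (Nat.cast_nonneg T))
    (tendsto_add_mul_add_div (V s) (-C) G)
  have h := le_partialReward hρ zero_le_one (d := d)
    (by simpa only [one_smul] using fun s => (hV s).trans_eq (hd s)) (C := -C)
    (fun s => (hC ⟨s, rfl⟩).trans_eq (neg_neg C).symm) T [] s
  simpa only [partialReward, one_pow, one_mul, Finset.sum_const, Finset.card_range, nsmul_one]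
    using h

theorem IsGain.optimalAverage_eq
    (hg : IsGain (bellman (expectation ρ) (fun j τ => R0 j τ + W) R1) g)
    (hρ : ∀ s, ρ s ∈ stdSimplex ℝ (Fin K)) (hR0 : ∀ j, Antitone (R0 j)) (s : BeliefState K) :
    optimalAverage ρ R0 R1 W s = (g : EReal) := by
  obtain ⟨C, hC⟩ := hg
  have hbound : ∀ᶠ β in 𝓝[<] (1 : ℝ),
      ((g - (1 - β) * C : ℝ) : EReal) ≤ optimalAverage ρ R0 R1 W s ∧
        optimalAverage ρ R0 R1 W s ≤ ((g + (1 - β) * C : ℝ) : EReal) := by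
    filter_upwards [hC, eventually_mem_Ico_nhdsLT_one] with β hCβ hβ
    obtain ⟨V, hV, -⟩ := existsUnique_isDiscountedValue_bellman (R := R1)
      (isNonlinearExpectation_expectation hρ) (fun j => (hR0 j).add_const W) hβ
    have hVC := fun s => abs_le.1 (hCβ V hV s)
    refine ⟨le_optimalAverage (V := β • V) hρ ?_ (fun s => ?_) s,
      optimalAverage_le (V := β • V) hρ ?_ (fun s => ?_) s⟩
    · exact Set.range_smul β V ▸ hV.bddAbove.smul_of_nonneg hβ.1
    · rw [hV.apply_smul_eq]
      linarith [(hVC s).1]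
    · exact Set.range_smul β V ▸ hV.bddBelow.smul_of_nonneg hβ.1
    · rw [hV.apply_smul_eq]
      linarith [(hVC s).2]
  have hlim := tendsto_one_sub_mul_nhdsLT_one C
  have hlow := (continuous_coe_real_ereal.tendsto _).comp (hlim.const_sub g)
  have hupp := (continuous_coe_real_ereal.tendsto _).comp (hlim.const_add g)
  rw [sub_zero] at hlow
  rw [add_zero] at hupp
  exact le_antisymm (ge_of_tendsto hupp (hbound.mono fun _ h => h.2))
    (le_of_tendsto hlow (hbound.mono fun _ h => h.1))

end Policies

section WorstCase

variable {ι : Type*} {r : ι → ℕ+ → ℝ} {R β : ℝ} {V : ι × ℕ+ → ℝ}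

namespace IsDiscountedValue

/-- The arm with the smallest fresh value solves its own one-arm problem, in which being active
always refreshes that arm, and every other arm is worth at most its one-arm problem. -/
theorem iInf_fresh_eq [Finite ι] [Nonempty ι]
    (hV : IsDiscountedValue (bellman worstCase r R) β V) (hβ : β ∈ Set.Ico (0 : ℝ) 1)
    {U : ι → Unit × ℕ+ → ℝ}
    (hU : ∀ j, IsDiscountedValue (bellman bestCase (fun _ => r j) R) β (U j)) :
    ⨅ i, V (i, 1) = ⨅ j, U j ((), 1) := by
  have hbest (j : ι) : IsSubtopical (bellman bestCase (fun _ : Unit => r j) R) :=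
    (isTopical_bellman isNonlinearExpectation_bestCase.isTopical).isSubtopical
  have hbdd (j : ι) : Set.range (fun s : Unit × ℕ+ => V (j, s.2)) ⊆ Set.range V :=
    Set.range_comp_subset_range (fun s : Unit × ℕ+ => (j, s.2)) V
  obtain ⟨l, hl⟩ := Finite.exists_min fun i => V (i, 1)
  have hβl : ∀ j, β * V (l, 1) ≤ β * V (j, 1) := fun j => mul_le_mul_of_nonneg_left (hl j) hβ.1
  have hinf (f : ι → ℝ) (hf : ∀ j, f l ≤ f j) : ⨅ i, f i = f l :=
    (ciInf_le (Set.finite_range f).bddBelow l).antisymm (le_ciInf hf)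
  have harm (j : ι) (τ : ℕ+) :
      V (j, τ) = max (r j τ + β * V (j, τ + 1)) (R + β * V (l, 1)) :=
    (congrFun hV.eq_apply (j, τ)).trans (congrArg (max _ <| R + ·) (hinf _ hβl))
  have hone (j : ι) (s : Unit × ℕ+) :
      bellman bestCase (fun _ => r j) R (β • fun s : Unit × ℕ+ => V (j, s.2)) s =
        max (r j s.2 + β * V (j, s.2 + 1)) (R + β * V (j, 1)) :=
    congrArg (max _ <| R + ·) (ciSup_const (a := β * V (j, 1)))
  have hle (j : ι) : V (j, 1) ≤ U j ((), 1) :=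
    (hU j).le_of_le_apply (hbest j) hβ (hV.bddAbove.mono (hbdd j)) (fun s => (harm j s.2).trans_le
      ((max_le_max le_rfl (add_le_add_right (hβl j) R)).trans_eq (hone j s).symm)) ((), 1)
  have hge : U l ((), 1) ≤ V (l, 1) :=
    (hU l).le_of_apply_le (hbest l) hβ (hV.bddBelow.mono (hbdd l))
      (fun s => ((hone l s).trans (harm l s.2).symm).le) ((), 1)
  rw [hinf _ hl, hinf _ fun j => hge.trans ((hl j).trans (hle j))]
  exact (hle l).antisymm hge

end IsDiscountedValue

theorem exists_tendsto_one_sub_mul_iInf_fresh [Finite ι] [Nonempty ι] (hr : ∀ j, Antitone (r j))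
    {V : ℝ → ι × ℕ+ → ℝ}
    (hV : ∀ β ∈ Set.Ico (0 : ℝ) 1, IsDiscountedValue (bellman worstCase r R) β (V β)) :
    ∃ μ, Tendsto (fun β => (1 - β) * ⨅ i, V β (i, 1)) (𝓝[<] 1) (𝓝 μ) := by
  choose g hg using fun j => exists_isGain_bellman_bestCase (fun _ : Unit => hr j) R
  have hΦ := isNonlinearExpectation_bestCase (ι := Unit) (S := Unit × ℕ+)
  choose! U hU using fun β (hβ : β ∈ Set.Ico (0 : ℝ) 1) j =>
    (existsUnique_isDiscountedValue_bellman (R := R) hΦ (fun _ => hr j) hβ).exists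
  have hlim : Tendsto (fun β => ⨅ j, (1 - β) * U β j ((), 1)) (𝓝[<] 1) (𝓝 (⨅ j, g j)) := by
    cases nonempty_fintype ι
    simp only [← Finset.inf'_univ_eq_ciInf]
    exact Tendsto.finset_inf'_nhds_apply Finset.univ_nonempty fun j _ =>
      (hg j).tendsto (fun β hβ => hU β hβ j) ((), 1)
  refine ⟨_, hlim.congr' ?_⟩
  filter_upwards [eventually_mem_Ico_nhdsLT_one] with β hβ
  rw [(hV β hβ).iInf_fresh_eq hβ (hU β hβ), Real.mul_iInf_of_nonneg (sub_pos.2 hβ.2).le]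

theorem exists_tendsto_one_sub_mul_worstCase [Finite ι] [Nonempty ι] (hr : ∀ j, Antitone (r j))
    {V : ℝ → ι × ℕ+ → ℝ}
    (hV : ∀ β ∈ Set.Ico (0 : ℝ) 1, IsDiscountedValue (bellman worstCase r R) β (V β))
    (s : ι × ℕ+) : ∃ g, Tendsto (fun β => (1 - β) * V β s) (𝓝[<] 1) (𝓝 g) := by
  obtain ⟨μ, hμ⟩ := exists_tendsto_one_sub_mul_iInf_fresh hr hV
  have hp : Tendsto (fun β => (1 - β) * (R + ⨅ i, β * V β (i, 1))) (𝓝[<] 1) (𝓝 μ) := by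
    have hβ : Tendsto (fun β : ℝ => β) (𝓝[<] 1) (𝓝 1) := nhdsWithin_le_nhds
    have h := (tendsto_one_sub_mul_nhdsLT_one R).add (hβ.mul hμ)
    rw [one_mul, zero_add] at h
    refine h.congr' ?_
    filter_upwards [eventually_mem_Ico_nhdsLT_one] with β hβ
    rw [← Real.mul_iInf_of_nonneg hβ.1]
    ring
  exact ⟨_, tendsto_one_sub_mul_stopping (hr s.1) (fun β hβ => (hV β hβ).bellman_arm s.1) hp s.2⟩

end WorstCase

section Observations

variable {K : ℕ} {P : Matrix (Fin K) (Fin K) ℝ} {ps : Fin K → ℝ}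

theorem exactObs_mem_stdSimplex (hP : P ∈ rowStochastic ℝ (Fin K)) (s : BeliefState K) :
    exactObs P s ∈ stdSimplex ℝ (Fin K) :=
  ⟨fun _ => nonneg_of_mem_rowStochastic (pow_mem hP _),
    sum_row_of_mem_rowStochastic (pow_mem hP _) s.1⟩

theorem activeMatrix_exactObs (P : Matrix (Fin K) (Fin K) ℝ) : activeMatrix (exactObs P) = P :=
  pow_one P

theorem vecMul_pow_eq_self {n : Type*} [Fintype n] [DecidableEq n] {Q : Matrix n n ℝ} {v : n → ℝ}
    (hv : v ᵥ* Q = v) (m : ℕ) : v ᵥ* Q ^ m = v := by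
  induction m with
  | zero => rw [pow_zero, vecMul_one]
  | succ m ih => rw [pow_succ, ← vecMul_vecMul, ih, hv]

theorem pos_of_vecMul_eq_self {n : Type*} [Fintype n] {Q : Matrix n n ℝ}
    (hQ : Q.IsIrreducible) {v : n → ℝ} (hv : v ∈ stdSimplex ℝ n) (hvQ : v ᵥ* Q = v) (k : n) :
    0 < v k := by
  classical
  obtain ⟨i, -, hi⟩ := Finset.exists_lt_of_sum_lt (s := Finset.univ) (f := 0) (g := v)
    (by simp [hv.2])
  obtain ⟨m, -, hm⟩ := (isIrreducible_iff_exists_pow_pos hQ.nonneg).1 hQ i k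
  rw [← vecMul_pow_eq_self hvQ m]
  exact (mul_pos hi hm).trans_le (Finset.single_le_sum (f := fun i => v i * (Q ^ m) i k)
    (fun i _ => mul_nonneg (hv.1 i) (pow_apply_nonneg hQ.nonneg m i k)) (Finset.mem_univ i))

theorem isIrreducible_activeMatrix_approxObs (hps : ∀ i, 0 < ps i) :
    (activeMatrix (approxObs ps)).IsIrreducible :=
  IsPrimitive.isIrreducible ⟨fun _ i => (hps i).le, 1, one_pos, fun i k =>
    (hps k).trans_eq (congrFun₂ (pow_one (activeMatrix (approxObs ps))) i k).symm⟩

end Observations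

theorem exists_optimalAverage_eq {K : ℕ} [NeZero K] {ρ : BeliefState K → Fin K → ℝ}
    {R0 : Fin K → ℕ+ → ℝ} (hρ : ∀ s, ρ s ∈ stdSimplex ℝ (Fin K))
    (hirr : (activeMatrix ρ).IsIrreducible) (hR0 : ∀ j, Antitone (R0 j)) (R1 W : ℝ) :
    ∃ (g : ℝ) (V : ℝ → BeliefState K → ℝ), (∀ s, optimalAverage ρ R0 R1 W s = (g : EReal)) ∧
      R1 ≤ g ∧
      (∀ β ∈ Set.Ico (0 : ℝ) 1,
        IsDiscountedValue (bellman (expectation ρ) (fun j τ => R0 j τ + W) R1) β (V β)) ∧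
      ∀ s, Tendsto (fun β => (1 - β) * V β s) (𝓝[<] 1) (𝓝 g) := by
  have hΦ := isNonlinearExpectation_expectation hρ
  have hr : ∀ j, Antitone fun τ => R0 j τ + W := fun j => (hR0 j).add_const W
  obtain ⟨g, hg⟩ := exists_isGain_bellman_expectation hρ hirr hr R1
  choose! V hV using fun β (hβ : β ∈ Set.Ico (0 : ℝ) 1) =>
    (existsUnique_isDiscountedValue_bellman (R := R1) hΦ hr hβ).exists
  exact ⟨g, V, hg.optimalAverage_eq hρ hR0,
    le_of_tendsto_one_sub_mul_bellman hΦ hV (hg.tendsto hV (0, 1)), hV, hg.tendsto hV⟩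

section ExtremeValues

variable {K : ℕ} {ρ : BeliefState K → Fin K → ℝ} {R0 : Fin K → ℕ+ → ℝ} {R1 W β : ℝ}

theorem isMaxValue_iff {V : BeliefState K → ℝ} (hβ : 0 ≤ β) : IsMaxValue R0 R1 W β V ↔
    IsDiscountedValue (bellman bestCase (fun j τ => R0 j τ + W) R1) β V := by
  simp only [IsMaxValue, Real.mul_iSup_of_nonneg hβ]
  exact ⟨fun h => ⟨h.1, funext fun s => h.2 s.1 s.2⟩,
    fun h => ⟨h.bounded, fun j τ => congrFun h.eq_apply (j, τ)⟩⟩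

theorem isMinValue_iff {V : BeliefState K → ℝ} (hβ : 0 ≤ β) : IsMinValue R0 R1 W β V ↔
    IsDiscountedValue (bellman worstCase (fun j τ => R0 j τ + W) R1) β V := by
  simp only [IsMinValue, Real.mul_iInf_of_nonneg hβ]
  exact ⟨fun h => ⟨h.1, funext fun s => h.2 s.1 s.2⟩,
    fun h => ⟨h.bounded, fun j τ => congrFun h.eq_apply (j, τ)⟩⟩

theorem IsMaxValue.discountedValue_le [NeZero K] {V : BeliefState K → ℝ}
    (hV : IsMaxValue R0 R1 W β V)
    (hρ : ∀ s, ρ s ∈ stdSimplex ℝ (Fin K)) (hR0 : ∀ j, Antitone (R0 j))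
    (hβ : β ∈ Set.Ico (0 : ℝ) 1) (s : BeliefState K) :
    discountedValue ρ R0 R1 W β s ≤ (V s : EReal) := by
  have hΦ := isNonlinearExpectation_expectation hρ
  obtain ⟨U, hU, -⟩ := existsUnique_isDiscountedValue_bellman (R := R1) hΦ
    (fun j => (hR0 j).add_const W) hβ
  rw [hU.discountedValue_eq hρ hβ, EReal.coe_le_coe_iff]
  exact hU.mono ((isMaxValue_iff hβ.1).1 hV)
    (isTopical_bellman isNonlinearExpectation_bestCase.isTopical).isSubtopical hβ
    (bellman_mono hΦ.le_bestCase) s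

theorem IsMinValue.le_discountedValue {V : BeliefState K → ℝ}
    (hV : IsMinValue R0 R1 W β V)
    (hρ : ∀ s, ρ s ∈ stdSimplex ℝ (Fin K)) (hR0 : ∀ j, Antitone (R0 j))
    (hβ : β ∈ Set.Ico (0 : ℝ) 1) (s : BeliefState K) :
    (V s : EReal) ≤ discountedValue ρ R0 R1 W β s := by
  have hΦ := isNonlinearExpectation_expectation hρ
  obtain ⟨U, hU, -⟩ := existsUnique_isDiscountedValue_bellman (R := R1) hΦ
    (fun j => (hR0 j).add_const W) hβ
  rw [hU.discountedValue_eq hρ hβ, EReal.coe_le_coe_iff]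
  exact ((isMinValue_iff hβ.1).1 hV).mono hU (isTopical_bellman hΦ.isTopical).isSubtopical hβ
    (bellman_mono hΦ.worstCase_le) s

theorem existsUnique_isMaxValue [NeZero K] (hR0 : ∀ j, Antitone (R0 j)) (R1 W : ℝ)
    (hβ : β ∈ Set.Ico (0 : ℝ) 1) : ∃! V, IsMaxValue R0 R1 W β V := by
  simp only [isMaxValue_iff hβ.1]
  exact existsUnique_isDiscountedValue_bellman isNonlinearExpectation_bestCase
    (fun j => (hR0 j).add_const W) hβ

theorem existsUnique_isMinValue [NeZero K] (hR0 : ∀ j, Antitone (R0 j)) (R1 W : ℝ)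
    (hβ : β ∈ Set.Ico (0 : ℝ) 1) : ∃! V, IsMinValue R0 R1 W β V := by
  simp only [isMinValue_iff hβ.1]
  exact existsUnique_isDiscountedValue_bellman isNonlinearExpectation_worstCase
    (fun j => (hR0 j).add_const W) hβ

variable {V U : ℝ → BeliefState K → ℝ}

theorem exists_tendsto_one_sub_mul_isMaxValue [NeZero K] (hR0 : ∀ j, Antitone (R0 j))
    (hV : ∀ β ∈ Set.Ico (0 : ℝ) 1, IsMaxValue R0 R1 W β (V β)) :
    ∃ g, ∀ s, Tendsto (fun β => (1 - β) * V β s) (𝓝[<] 1) (𝓝 g) :=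
  let ⟨g, hg⟩ := exists_isGain_bellman_bestCase (fun j => (hR0 j).add_const W) R1
  ⟨g, hg.tendsto fun β hβ => (isMaxValue_iff hβ.1).1 (hV β hβ)⟩

theorem exists_tendsto_one_sub_mul_isMinValue [NeZero K] (hR0 : ∀ j, Antitone (R0 j))
    (hV : ∀ β ∈ Set.Ico (0 : ℝ) 1, IsMinValue R0 R1 W β (V β)) (s : BeliefState K) :
    ∃ g, R1 ≤ g ∧ Tendsto (fun β => (1 - β) * V β s) (𝓝[<] 1) (𝓝 g) := by
  replace hV := fun β hβ => (isMinValue_iff hβ.1).1 (hV β hβ)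
  obtain ⟨g, hg⟩ := exists_tendsto_one_sub_mul_worstCase (fun j => (hR0 j).add_const W) hV s
  exact ⟨g, le_of_tendsto_one_sub_mul_bellman isNonlinearExpectation_worstCase hV hg, hg⟩

theorem le_of_tendsto_isMinValue (hρ : ∀ s, ρ s ∈ stdSimplex ℝ (Fin K))
    (hV : ∀ β ∈ Set.Ico (0 : ℝ) 1, IsMinValue R0 R1 W β (V β))
    (hU : ∀ β ∈ Set.Ico (0 : ℝ) 1,
      IsDiscountedValue (bellman (expectation ρ) (fun j τ => R0 j τ + W) R1) β (U β))
    {s : BeliefState K} {a b : ℝ} (ha : Tendsto (fun β => (1 - β) * V β s) (𝓝[<] 1) (𝓝 a))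
    (hb : Tendsto (fun β => (1 - β) * U β s) (𝓝[<] 1) (𝓝 b)) : a ≤ b :=
  have hΦ := isNonlinearExpectation_expectation hρ
  le_of_tendsto_one_sub_mul (isTopical_bellman hΦ.isTopical).isSubtopical
    (bellman_mono hΦ.worstCase_le) (fun β hβ => (isMinValue_iff hβ.1).1 (hV β hβ)) hU ha hb

theorem le_of_tendsto_isMaxValue [NeZero K] (hρ : ∀ s, ρ s ∈ stdSimplex ℝ (Fin K))
    (hV : ∀ β ∈ Set.Ico (0 : ℝ) 1,
      IsDiscountedValue (bellman (expectation ρ) (fun j τ => R0 j τ + W) R1) β (V β))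
    (hU : ∀ β ∈ Set.Ico (0 : ℝ) 1, IsMaxValue R0 R1 W β (U β))
    {s : BeliefState K} {a b : ℝ} (ha : Tendsto (fun β => (1 - β) * V β s) (𝓝[<] 1) (𝓝 a))
    (hb : Tendsto (fun β => (1 - β) * U β s) (𝓝[<] 1) (𝓝 b)) : a ≤ b :=
  le_of_tendsto_one_sub_mul
    (isTopical_bellman isNonlinearExpectation_bestCase.isTopical).isSubtopical
    (bellman_mono (isNonlinearExpectation_expectation hρ).le_bestCase) hV
    (fun β hβ => (isMaxValue_iff hβ.1).1 (hU β hβ)) ha hb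

end ExtremeValues

theorem abs_one_sub_div_le {g x a b : ℝ} (hx : 0 ≤ x) (ha : 0 < a) (hag : a ≤ g) (hgb : g ≤ b) :
    |1 - x / g| ≤ max (1 - x / b) (x / a - 1) := by
  refine abs_le'.2 ⟨le_max_of_le_left ?_, le_max_of_le_right ?_⟩
  · exact sub_le_sub_left (div_le_div_of_nonneg_left hx (ha.trans_le hag) hgb) 1
  · rw [neg_sub]
    exact sub_le_sub_right (div_le_div_of_nonneg_left hx ha hag) 1

end PilotAllocation

end

open PilotAllocation in
theorem proposition2_general {K : ℕ} [NeZero K]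
    (P : Matrix (Fin K) (Fin K) ℝ) (hP : P ∈ Matrix.rowStochastic ℝ (Fin K))
    (R0 : Fin K → ℕ+ → ℝ) (R1 W : ℝ)
    (hR0 : ∀ j, Antitone (R0 j)) :
    (∀ β ∈ Set.Ico (0 : ℝ) 1,
      (∃! V, IsMaxValue R0 R1 W β V) ∧
      (∃! V, IsMinValue R0 R1 W β V) ∧
      ∀ Vmax Vmin : BeliefState K → ℝ,
        IsMaxValue R0 R1 W β Vmax →
        IsMinValue R0 R1 W β Vmin →
        ∀ s,
          discountedValue (exactObs P) R0 R1 W β s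
            ≤ (Vmax s : EReal) ∧
          (Vmin s : EReal)
            ≤ discountedValue (exactObs P) R0 R1 W β s) ∧
    (P.IsIrreducible → 0 < R1 →
      ∀ ps ∈ stdSimplex ℝ (Fin K), ps ᵥ* P = ps →
      ∀ Vmax Vmin : ℝ → BeliefState K → ℝ,
        (∀ β ∈ Set.Ico (0 : ℝ) 1, IsMaxValue R0 R1 W β (Vmax β)) →
        (∀ β ∈ Set.Ico (0 : ℝ) 1, IsMinValue R0 R1 W β (Vmin β)) →
        ∃ (g gapp gmax : ℝ) (gmin : BeliefState K → ℝ),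
          (∀ s, optimalAverage (exactObs P) R0 R1 W s
            = (g : EReal)) ∧
          (∀ s, optimalAverage (approxObs ps) R0 R1 W s
            = (gapp : EReal)) ∧
          (∀ s, Tendsto (fun β => (1 - β) * Vmax β s) (𝓝[<] 1) (𝓝 gmax)) ∧
          (∀ s, Tendsto (fun β => (1 - β) * Vmin β s) (𝓝[<] 1) (𝓝 (gmin s))) ∧
          (∀ s, 0 < gmin s ∧ gmin s ≤ g ∧ g ≤ gmax) ∧
          ∀ s, |1 - gapp / g| ≤ max (1 - gapp / gmax) (gapp / gmin s - 1)) := by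
  have hρ := exactObs_mem_stdSimplex hP
  refine ⟨fun β hβ => ⟨existsUnique_isMaxValue hR0 R1 W hβ, existsUnique_isMinValue hR0 R1 W hβ,
    fun _ _ hmax hmin s =>
      ⟨hmax.discountedValue_le hρ hR0 hβ s, hmin.le_discountedValue hρ hR0 hβ s⟩⟩,
    fun hirr hR1 ps hps hst Vmax Vmin hmax hmin => ?_⟩
  obtain ⟨g, V, hg, -, hV, hVg⟩ :=
    exists_optimalAverage_eq hρ ((activeMatrix_exactObs P).symm ▸ hirr) hR0 R1 W
  obtain ⟨gapp, _, hgapp, happ, -, -⟩ := exists_optimalAverage_eq (ρ := approxObs ps)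
    (fun _ => hps) (isIrreducible_activeMatrix_approxObs (pos_of_vecMul_eq_self hirr hps hst))
    hR0 R1 W
  obtain ⟨gmax, hgmax⟩ := exists_tendsto_one_sub_mul_isMaxValue hR0 hmax
  choose gmin hR1gmin hgmin using exists_tendsto_one_sub_mul_isMinValue hR0 hmin
  have hpos : ∀ s, 0 < gmin s := fun s => hR1.trans_le (hR1gmin s)
  have hlow : ∀ s, gmin s ≤ g := fun s => le_of_tendsto_isMinValue hρ hmin hV (hgmin s) (hVg s)
  have hupp : g ≤ gmax := le_of_tendsto_isMaxValue hρ hV hmax (hVg (0, 1)) (hgmax (0, 1))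
  exact ⟨g, gapp, gmax, gmin, hg, hgapp, hgmax, hgmin, fun s => ⟨hpos s, hlow s, hupp⟩,
    fun s => abs_one_sub_div_le (hR1.le.trans happ) (hpos s) (hlow s) hupp⟩

theorem proposition2 {K : ℕ} [NeZero K]
    (P : Matrix (Fin K) (Fin K) ℝ) (hP : P ∈ Matrix.rowStochastic ℝ (Fin K))
    (R0 : Fin K → ℕ+ → ℝ) (R1 W : ℝ)
    (hR0 : ∀ j, Antitone (R0 j)) (hR1 : ∀ j τ, R0 j τ ≤ R1) :
    -- the value functions and the sandwich, for every discount factor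
    (∀ β ∈ Set.Ico (0 : ℝ) 1,
      (∃! V, PilotAllocation.IsMaxValue R0 R1 W β V) ∧
      (∃! V, PilotAllocation.IsMinValue R0 R1 W β V) ∧
      ∀ Vmax Vmin : PilotAllocation.BeliefState K → ℝ,
        PilotAllocation.IsMaxValue R0 R1 W β Vmax →
        PilotAllocation.IsMinValue R0 R1 W β Vmin →
        ∀ s,
          PilotAllocation.discountedValue (PilotAllocation.exactObs P) R0 R1 W β s
            ≤ (Vmax s : EReal) ∧
          (Vmin s : EReal)
            ≤ PilotAllocation.discountedValue (PilotAllocation.exactObs P) R0 R1 W β s) ∧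
    -- the error bound for the average reward
    (P.IsIrreducible → 0 < R1 →
      ∀ ps ∈ stdSimplex ℝ (Fin K), ps ᵥ* P = ps →
      ∀ Vmax Vmin : ℝ → PilotAllocation.BeliefState K → ℝ,
        (∀ β ∈ Set.Ico (0 : ℝ) 1, PilotAllocation.IsMaxValue R0 R1 W β (Vmax β)) →
        (∀ β ∈ Set.Ico (0 : ℝ) 1, PilotAllocation.IsMinValue R0 R1 W β (Vmin β)) →
        ∃ (g gapp gmax : ℝ) (gmin : PilotAllocation.BeliefState K → ℝ),
          (∀ s, PilotAllocation.optimalAverage (PilotAllocation.exactObs P) R0 R1 W s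
            = (g : EReal)) ∧
          (∀ s, PilotAllocation.optimalAverage (PilotAllocation.approxObs ps) R0 R1 W s
            = (gapp : EReal)) ∧
          (∀ s, Tendsto (fun β => (1 - β) * Vmax β s) (𝓝[<] 1) (𝓝 gmax)) ∧
          (∀ s, Tendsto (fun β => (1 - β) * Vmin β s) (𝓝[<] 1) (𝓝 (gmin s))) ∧
          (∀ s, 0 < gmin s ∧ gmin s ≤ g ∧ g ≤ gmax) ∧
          ∀ s, |1 - gapp / g| ≤ max (1 - gapp / gmax) (gapp / gmin s - 1)) :=
  proposition2_general P hP R0 R1 W hR0
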